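/- **Theorem 1.** Let $(M,g)$ be a compact smooth Riemannian manifold (without boundary) of dimension $n$, let $(\bar M,\bar g)$ be a smooth Riemannian manifold of dimension $m$, and let $f:M\to\bar M$ be a smooth map with differential $f_*$. Let $g^*=f^*\bar g$ be the pullback metric, $e(f)=\operatorname{trace}_g g^*$ the energy density, $E_U(f)=\frac12\int_U e(f)\,dv_g$ the energy of $f$ on an open set $U\subseteq M$, and $\tau(f)=\operatorname{trace}_g(Df_*)$ the tension field, where $(Df_*)(X,Y)=\bar\nabla'_X f_*Y-f_*\nabla_XY$ with $\nabla$ the Levi-Civita connection of $g$ and $\bar\nabla'$ the connection on $f^*T\bar M$ induced by the Levi-Civita connection of $\bar g$. For a symmetric 2-tensor field $\varphi$ on $M$ let $(\delta\varphi)(Y)=-\sum_{i=1}^n(\nabla_{X_i}\varphi)(X_i,Y)$, where $X_1,\dots,X_n$ is a local $g$-orthonormal frame. The map $f$ is called harmonic if for every relatively compact open $U\subseteq M$ and every smooth variation $(f_t)_{|t|<\varepsilon}$ of $f_0=f$ with compact support in $U$ one has $\frac{d}{dt}\big|_{t=0}E_U(f_t)=0$. 1. For every $x\in M$ and $Y\in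 T_xM$, $$(\delta g^*)(Y)+\tfrac12\,de(f)(Y)=-\bar g\big(\tau(f),f_*Y\big).$$ 2. If $f$ is harmonic, then $\delta g^*=-\frac12\,d e(f)$. 3. Conversely, if $\delta g^*=-\frac12\,d e(f)$ and either $n=m$ and $f$ is a diffeomorphism, or $n\ge m$ and $f$ is a submersion, then $f$ is harmonic. -/

import Mathlib

open Bundle Set MeasureTheory
open scoped Manifold ContDiff Topology

noncomputable section

namespace HarmonicMap

/-- Smooth Riemannian metrics on a smooth `n`-manifold `M` without boundary. -/
abbrev Metric (n : ℕ) (M : Type*) [TopologicalSpace M] [ChartedSpace (EuclideanSpace ℝ (Fin n)) M]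
    [IsManifold (𝓡 n) ∞ M] :=
  ContMDiffRiemannianMetric (𝓡 n) ∞ (EuclideanSpace ℝ (Fin n))
    (fun x : M => TangentSpace (𝓡 n) x)

/-- Fields of bilinear forms on the tangent spaces of `M` (covariant 2-tensor fields). -/
abbrev Tensor2 (n : ℕ) (M : Type*) [TopologicalSpace M]
    [ChartedSpace (EuclideanSpace ℝ (Fin n)) M] :=
  (x : M) → LinearMap.BilinForm ℝ (TangentSpace (𝓡 n) x)

section Coordinates

variable {n : ℕ} {M : Type*} [TopologicalSpace M] [ChartedSpace (EuclideanSpace ℝ (Fin n)) M]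

/-- The partial derivative `∂F/∂yⁱ` of a real function on `ℝⁿ`. -/
def pd (i : Fin n) (F : EuclideanSpace ℝ (Fin n) → ℝ) (y : EuclideanSpace ℝ (Fin n)) : ℝ :=
  fderiv ℝ F y (EuclideanSpace.single i 1)

/-- The coordinate vector field `∂ᵢ` of the chart at `p`, at the point with coordinates `y`. -/
def coordVec (p : M) (i : Fin n) (y : EuclideanSpace ℝ (Fin n)) :
    TangentSpace (𝓡 n) ((extChartAt (𝓡 n) p).symm y) :=
  mfderiv 𝓘(ℝ, EuclideanSpace ℝ (Fin n)) (𝓡 n) (extChartAt (𝓡 n) p).symm y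
    (EuclideanSpace.single i (1 : ℝ) : EuclideanSpace ℝ (Fin n))

/-- The component `Yʲ` of a tangent vector `Y` at `x` in the chart at `x`, so that
`Y = ∑ⱼ Yʲ ∂ⱼ`. -/
def component (x : M) (Y : TangentSpace (𝓡 n) x) (j : Fin n) : ℝ :=
  (show EuclideanSpace ℝ (Fin n) from
    mfderiv (𝓡 n) 𝓘(ℝ, EuclideanSpace ℝ (Fin n)) (extChartAt (𝓡 n) x) x Y) j

/-- The matrix `φᵢⱼ = φ(∂ᵢ, ∂ⱼ)` of a 2-tensor field in the chart at `p`, as a function of the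
coordinates `y`. -/
def coeff (φ : Tensor2 n M) (p : M) (y : EuclideanSpace ℝ (Fin n)) : Matrix (Fin n) (Fin n) ℝ :=
  Matrix.of fun i j => φ ((extChartAt (𝓡 n) p).symm y) (coordVec p i y) (coordVec p j y)

variable [IsManifold (𝓡 n) ∞ M]

/-- The metric `g` as a 2-tensor field. -/
def metricTensor (g : Metric n M) : Tensor2 n M := fun x =>
  LinearMap.mk₂ ℝ (fun v w => g.inner x v w) (by simp) (by simp) (by simp) (by simp)

/-- The inverse matrix `gⁱʲ` of the metric in the chart at `p`. -/
def invCoeff (g : Metric n M) (p : M) (y : EuclideanSpace ℝ (Fin n)) : Matrix (Fin n) (Fin n) ℝ :=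
  (coeff (metricTensor g) p y)⁻¹

/-- The Christoffel symbols of the Levi-Civita connection of `g` in the chart at `p`:
`Γᵏᵢⱼ = ½ ∑ₗ gᵏˡ (∂ᵢ gⱼₗ + ∂ⱼ gᵢₗ - ∂ₗ gᵢⱼ)`, that is, `∇_{∂ᵢ} ∂ⱼ = ∑ₖ Γᵏᵢⱼ ∂ₖ`. -/
def christoffel (g : Metric n M) (p : M) (k i j : Fin n) (y : EuclideanSpace ℝ (Fin n)) : ℝ :=
  (1 / 2) * ∑ l, invCoeff g p y k l *
    (pd i (fun z => coeff (metricTensor g) p z j l) y + pd j (fun z => coeff (metricTensor g) p z i l) y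
      - pd l (fun z => coeff (metricTensor g) p z i j) y)

/-- The components `(∇_{∂ₖ} φ)(∂ᵢ, ∂ⱼ)` of the covariant derivative of a 2-tensor field with respect
to the Levi-Civita connection of `g`, in the chart at `p`. -/
def covDeriv (g : Metric n M) (φ : Tensor2 n M) (p : M) (k i j : Fin n)
    (y : EuclideanSpace ℝ (Fin n)) : ℝ :=
  pd k (fun z => coeff φ p z i j) y
    - ∑ l, christoffel g p l k i y * coeff φ p y l j
    - ∑ l, christoffel g p l k j y * coeff φ p y i l

/-- The divergence `δφ` of a symmetric 2-tensor field, a 1-form: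
`(δφ)(Y) = - trace_g ((X, X') ↦ (∇_X φ)(X', Y))`, computed at `x` in the chart at `x`. -/
def divergence (g : Metric n M) (φ : Tensor2 n M) (x : M) (Y : TangentSpace (𝓡 n) x) : ℝ :=
  -∑ j, (∑ k, ∑ i, invCoeff g x (extChartAt (𝓡 n) x x) k i *
    covDeriv g φ x k i j (extChartAt (𝓡 n) x x)) * component x Y j

/-- The function `trace_g φ = ∑ᵢⱼ gⁱʲ φᵢⱼ`, computed at `x` in the chart at `x`. -/
def traceMetric (g : Metric n M) (φ : Tensor2 n M) (x : M) : ℝ :=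
  ∑ i, ∑ j, invCoeff g x (extChartAt (𝓡 n) x x) i j * coeff φ x (extChartAt (𝓡 n) x x) i j

/-- The measure `√(det gᵢⱼ) dy¹ ⋯ dyⁿ` on the domain of the chart at `p`, extended by zero
to `M`. -/
def chartVolume [MeasurableSpace M] (g : Metric n M) (p : M) : Measure M :=
  (((volume : Measure (EuclideanSpace ℝ (Fin n))).restrict (extChartAt (𝓡 n) p).target).withDensity
    (fun y => ENNReal.ofReal (Real.sqrt (coeff (metricTensor g) p y).det))).map (extChartAt (𝓡 n) p).symm

/-- The Riemannian volume measure `dv_g`: the least measure that dominates the measures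
`√(det gᵢⱼ) dy¹ ⋯ dyⁿ` of all the charts. Since those agree on overlaps of chart domains, this is the
measure that is given by `√(det gᵢⱼ) dy¹ ⋯ dyⁿ` on each chart domain. -/
def riemannianVolume [MeasurableSpace M] (g : Metric n M) : Measure M :=
  ⨆ p : M, chartVolume g p

end Coordinates

section Maps

variable {n m : ℕ}
  {M : Type*} [TopologicalSpace M] [ChartedSpace (EuclideanSpace ℝ (Fin n)) M]
  {N : Type*} [TopologicalSpace N] [ChartedSpace (EuclideanSpace ℝ (Fin m)) N]
  [IsManifold (𝓡 m) ∞ N]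

/-- The pullback metric (first fundamental form) `g* = f*h`. -/
def pullbackMetric (h : Metric m N) (f : M → N) : Tensor2 n M := fun x =>
  LinearMap.mk₂ ℝ
    (fun v w => h.inner (f x) (mfderiv (𝓡 n) (𝓡 m) f x v) (mfderiv (𝓡 n) (𝓡 m) f x w))
    (by simp) (by simp) (by simp) (by simp)

variable [IsManifold (𝓡 n) ∞ M]

/-- The energy density `e(f) = trace_g (f*h)`. -/
def energyDensity (g : Metric n M) (h : Metric m N) (f : M → N) (x : M) : ℝ :=
  traceMetric g (pullbackMetric h f) x

/-- The energy `E_U(f) = ½ ∫_U e(f) dv_g`. -/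
def energy [MeasurableSpace M] (g : Metric n M) (h : Metric m N) (U : Set M) (f : M → N) : ℝ :=
  (1 / 2) * ∫ x in U, energyDensity g h f x ∂(riemannianVolume g)

/-- `F` is a smooth variation `(fₜ)`, `-ε < t < ε`, of `f` with compact support in `U`. -/
structure IsVariation (n m : ℕ)
    {M : Type*} [TopologicalSpace M] [ChartedSpace (EuclideanSpace ℝ (Fin n)) M]
    {N : Type*} [TopologicalSpace N] [ChartedSpace (EuclideanSpace ℝ (Fin m)) N]
    (f : M → N) (U : Set M) (ε : ℝ) (F : ℝ → M → N) : Prop where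
  smooth : ContMDiffOn (𝓘(ℝ, ℝ).prod (𝓡 n)) (𝓡 m) ∞ (fun q : ℝ × M => F q.1 q.2)
    (Ioo (-ε) ε ×ˢ univ)
  initial : F 0 = f
  support : ∃ K : Set M, IsCompact K ∧ K ⊆ U ∧ ∀ t ∈ Ioo (-ε) ε, ∀ x ∉ K, F t x = f x

/-- A smooth map `f : (M, g) → (N, h)` is harmonic if, for every relatively compact open `U ⊆ M`, it
is a critical point of the energy `E_U` with respect to all smooth variations of `f` with compact
support in `U`. -/
def IsHarmonic [MeasurableSpace M] (g : Metric n M) (h : Metric m N) (f : M → N) : Prop :=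
  ContMDiff (𝓡 n) (𝓡 m) ∞ f ∧
  ∀ U : Set M, IsOpen U → IsCompact (closure U) → ∀ ε : ℝ, 0 < ε → ∀ F : ℝ → M → N,
    IsVariation n m f U ε F → HasDerivAt (fun t => energy g h U (F t)) 0 0

/-- The components `(Df_*)ᵅᵢⱼ = ∂ᵢ∂ⱼfᵅ - ∑ₖ Γᵏᵢⱼ ∂ₖfᵅ + ∑ Γ̄ᵅᵦᵧ(f) ∂ᵢfᵝ ∂ⱼfᵞ` at `x` of the second
fundamental form `(Df_*)(X, Y) = ∇̄_X (f_* Y) - f_* (∇_X Y)` in the charts at `x` and at `f x`. -/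
def secondFundamentalForm (g : Metric n M) (h : Metric m N) (f : M → N) (x : M)
    (a : Fin m) (i j : Fin n) : ℝ :=
  let y := extChartAt (𝓡 n) x x
  let fc : Fin m → EuclideanSpace ℝ (Fin n) → ℝ := fun b z =>
    writtenInExtChartAt (𝓡 n) (𝓡 m) x f z b
  pd i (pd j (fc a)) y - ∑ k, christoffel g x k i j y * pd k (fc a) y
    + ∑ b, ∑ c, christoffel h (f x) a b c (extChartAt (𝓡 m) (f x) (f x)) *
        pd i (fc b) y * pd j (fc c) y

/-- The tension field `τ(f) = trace_g (Df_*)`, a vector field along `f`. -/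
def tension (g : Metric n M) (h : Metric m N) (f : M → N) (x : M) : TangentSpace (𝓡 m) (f x) :=
  ∑ a, (∑ i, ∑ j, invCoeff g x (extChartAt (𝓡 n) x x) i j * secondFundamentalForm g h f x a i j) •
    (show TangentSpace (𝓡 m) (f x) from coordVec (f x) a (extChartAt (𝓡 m) (f x) (f x)))

/-- The identity `δ(f*h) = -½ d e(f)` of 1-forms on `M`. -/
def DivergenceIdentity (g : Metric n M) (h : Metric m N) (f : M → N) : Prop :=
  ∀ (x : M) (Y : TangentSpace (𝓡 n) x),
    divergence g (pullbackMetric h f) x Y = -(1 / 2) * mvfderiv (𝓡 n) (energyDensity g h f) x Y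

end Maps

end HarmonicMap

end

/-!
By metric compatibility, `∇_v g* (w, u) = ⟨II(v, w), f_* u⟩ + ⟨f_* w, II(v, u)⟩`, where `II = Df_*`
is the second fundamental form of `f`. Since `II` is symmetric, contracting `v` with `w` and
contracting `w` with `u` both produce the term `trace ⟨II(·, Y), f_* ·⟩`, which cancels in
`δg* + ½ de(f)` and leaves `-⟨τ(f), f_* Y⟩`.

For a variation with velocity field `V`, the same compatibility gives
`½ d/dt e(f_t) = div ⟨V, f_* ·⟩ - ⟨V, τ(f)⟩` at `t = 0`. The divergence integrates to zero, so the
derivative of the energy is `-∫ ⟨V, τ(f)⟩`. Taking for `V` a cut-off of a constant field in a chart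
of the target shows that `f` is harmonic if and only if `τ(f) = 0`. Where `f_*` is surjective,
`⟨τ(f), f_* Y⟩ = 0` for all `Y` forces `τ(f) = 0`.
-/

noncomputable section

namespace HarmonicMap

local notation "𝔼" k => EuclideanSpace ℝ (Fin k)

local notation "𝐞[" i "]" => EuclideanSpace.single i (1 : ℝ)

section MatrixCalculus

variable {E : Type*} [NormedAddCommGroup E] [NormedSpace ℝ E]
  {ι : Type*} [Fintype ι] {A B : E → Matrix ι ι ℝ} {y : E}

/-- The derivative of a matrix-valued function at `y` in the direction `v`, taken entrywise because
matrices carry no canonical norm. -/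
def entryDeriv (A : E → Matrix ι ι ℝ) (y v : E) : Matrix ι ι ℝ :=
  Matrix.of fun i j => fderiv ℝ (fun z => A z i j) y v

theorem entryDeriv_mul (hA : ∀ i j, DifferentiableAt ℝ (fun z => A z i j) y)
    (hB : ∀ i j, DifferentiableAt ℝ (fun z => B z i j) y) (v : E) :
    entryDeriv (fun z => A z * B z) y v = entryDeriv A y v * B y + A y * entryDeriv B y v := by
  ext i j
  simp only [entryDeriv, Matrix.mul_apply, Matrix.of_apply, Matrix.add_apply]
  rw [fderiv_fun_sum fun k _ => (hA i k).fun_mul (hB k j), sum_apply, ← Finset.sum_add_distrib]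
  refine Finset.sum_congr rfl fun k _ => ?_
  rw [fderiv_fun_mul (hA i k) (hB k j)]
  simp only [add_apply, smul_apply, smul_eq_mul]
  ring

variable [DecidableEq ι]

theorem contDiffAt_det {r : ℕ∞ω} (hA : ∀ i j, ContDiffAt ℝ r (fun z => A z i j) y) :
    ContDiffAt ℝ r (fun z => (A z).det) y := by
  simp only [Matrix.det_apply']
  exact ContDiffAt.sum fun σ _ => contDiffAt_const.mul (contDiffAt_prod fun i _ => hA _ _)

theorem contDiffAt_inv_entry {r : ℕ∞ω} (hA : ∀ i j, ContDiffAt ℝ r (fun z => A z i j) y)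
    (hdet : (A y).det ≠ 0) (i j : ι) : ContDiffAt ℝ r (fun z => (A z)⁻¹ i j) y := by
  simp only [Matrix.inv_def, Ring.inverse_eq_inv', Matrix.smul_apply, smul_eq_mul,
    Matrix.adjugate_apply]
  refine ((contDiffAt_det hA).inv hdet).mul (contDiffAt_det fun a b => ?_)
  simp only [Matrix.updateRow_apply]
  split_ifs
  · exact contDiffAt_const
  · exact hA _ _

theorem entryDeriv_inv (hA : ∀ i j, ContDiffAt ℝ 1 (fun z => A z i j) y) (hdet : (A y).det ≠ 0)
    (v : E) : entryDeriv (fun z => (A z)⁻¹) y v = -((A y)⁻¹ * entryDeriv A y v * (A y)⁻¹) := by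
  have hunit : IsUnit (A y).det := isUnit_iff_ne_zero.2 hdet
  have hcancel : entryDeriv (fun z => A z * (A z)⁻¹) y v = 0 := by
    ext i j
    have hconst : (fun z => (A z * (A z)⁻¹) i j) =ᶠ[𝓝 y] fun _ => (1 : Matrix ι ι ℝ) i j := by
      filter_upwards [(contDiffAt_det hA).continuousAt.eventually_ne hdet] with z hz
      rw [Matrix.mul_nonsing_inv _ (isUnit_iff_ne_zero.2 hz)]
    simp [entryDeriv, hconst.fderiv_eq]
  rw [entryDeriv_mul (fun i j => (hA i j).differentiableAt one_ne_zero)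
    fun i j => (contDiffAt_inv_entry hA hdet i j).differentiableAt one_ne_zero] at hcancel
  rw [← Matrix.nonsing_inv_mul_cancel_left (A y) (entryDeriv (fun z => (A z)⁻¹) y v) hunit,
    eq_neg_of_add_eq_zero_right hcancel, Matrix.mul_neg, Matrix.mul_assoc]

theorem sum_sign_mul_prod_erase_eq_cramer (A : Matrix ι ι ℝ) (b : ι → ℝ) (i : ι) :
    ∑ σ : Equiv.Perm ι, ((Equiv.Perm.sign σ : ℤ) : ℝ) *
      ((∏ j ∈ Finset.univ.erase i, A (σ j) j) * b (σ i)) = A.cramer b i := by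
  rw [Matrix.cramer_apply, Matrix.det_apply']
  refine Finset.sum_congr rfl fun σ _ => ?_
  rw [← Finset.mul_prod_erase Finset.univ _ (Finset.mem_univ i), Matrix.updateCol_self,
    mul_comm (b (σ i))]
  congr 2
  exact Finset.prod_congr rfl fun j hj => by rw [Matrix.updateCol_ne (Finset.ne_of_mem_erase hj)]

theorem fderiv_det_apply (hA : ∀ i j, DifferentiableAt ℝ (fun z => A z i j) y)
    (hdet : (A y).det ≠ 0) (v : E) :
    fderiv ℝ (fun z => (A z).det) y v = (A y).det * ((A y)⁻¹ * entryDeriv A y v).trace := by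
  have hderiv : HasFDerivAt (fun z => (A z).det) (∑ σ : Equiv.Perm ι,
      ((Equiv.Perm.sign σ : ℤ) : ℝ) • ∑ i, (∏ j ∈ Finset.univ.erase i, A y (σ j) j) •
        fderiv ℝ (fun z => A z (σ i) i) y) y := by
    simp only [Matrix.det_apply']
    exact HasFDerivAt.fun_sum fun σ _ =>
      (HasFDerivAt.finsetProd fun i _ => (hA _ _).hasFDerivAt).const_mul _
  have hadj : (A y).det • (A y)⁻¹ = (A y).adjugate := by
    rw [Matrix.inv_def, Ring.inverse_eq_inv', smul_inv_smul₀ hdet]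
  rw [hderiv.fderiv, ← smul_eq_mul, ← Matrix.trace_smul, ← Matrix.smul_mul, hadj]
  simp only [sum_apply, smul_apply, smul_eq_mul, Finset.mul_sum, Matrix.trace, Matrix.diag_apply]
  rw [Finset.sum_comm]
  refine Finset.sum_congr rfl fun i _ => ?_
  rw [sum_sign_mul_prod_erase_eq_cramer (A y) (fun k => fderiv ℝ (fun z => A z k i) y v),
    Matrix.cramer_eq_adjugate_mulVec]
  rfl

end MatrixCalculus

section BilinearCalculus

variable {E F X : Type*} [NormedAddCommGroup E] [NormedSpace ℝ E] [NormedAddCommGroup F]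
  [NormedSpace ℝ F] [NormedAddCommGroup X] [NormedSpace ℝ X] {u : E → X} {W V : E → F}
  {B : X → F →L[ℝ] F →L[ℝ] ℝ} {y : E}

set_option synthInstance.maxHeartbeats 100000 in
-- Normed-space instances on `F →L[ℝ] F →L[ℝ] ℝ` are slow to synthesize.
theorem fderiv_bilin (hB : DifferentiableAt ℝ B (u y))
    (hu : DifferentiableAt ℝ u y) (hW : DifferentiableAt ℝ W y) (hV : DifferentiableAt ℝ V y)
    (v : E) :
    fderiv ℝ (fun z => B (u z) (W z) (V z)) y v =
      fderiv ℝ B (u y) (fderiv ℝ u y v) (W y) (V y) +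
        (B (u y) (fderiv ℝ W y v) (V y) + B (u y) (W y) (fderiv ℝ V y v)) := by
  have hBu : DifferentiableAt ℝ (fun z => B (u z)) y :=
    DifferentiableAt.comp (G := F →L[ℝ] F →L[ℝ] ℝ) y hB hu
  rw [fderiv_clm_apply (hBu.clm_apply hW) hV, fderiv_clm_apply hBu hW,
    fderiv_fun_comp (G := F →L[ℝ] F →L[ℝ] ℝ) y hB hu]
  simp only [add_apply, ContinuousLinearMap.comp_apply, ContinuousLinearMap.flip_apply]
  ring

theorem fderiv_bilin_apply {z : X} (hB : DifferentiableAt ℝ B z) (x : X) (v w : F) :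
    fderiv ℝ B z x v w = fderiv ℝ (fun z => B z v w) z x := by
  rw [fderiv_bilin (u := fun z : X => z) hB differentiableAt_fun_id (differentiableAt_const v)
    (differentiableAt_const w)]
  simp

end BilinearCalculus

section StandardBasis

variable {n : ℕ}

theorem sum_smul_single (v : 𝔼 n) : ∑ i, v i • 𝐞[i] = v := by
  simpa using (EuclideanSpace.basisFun (Fin n) ℝ).sum_repr v

theorem bilin_eq_sum (B : (𝔼 n) →L[ℝ] (𝔼 n) →L[ℝ] ℝ) (v w : 𝔼 n) :
    B v w = ∑ i, ∑ j, v i * (B 𝐞[i] 𝐞[j] * w j) := by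
  conv_lhs => rw [← sum_smul_single v, ← sum_smul_single w]
  simp only [map_sum, map_smul, sum_apply, smul_apply, smul_eq_mul, Finset.mul_sum]
  rw [Finset.sum_comm]
  exact Finset.sum_congr rfl fun i _ => Finset.sum_congr rfl fun j _ => by ring

theorem clm_ext_single {X : Type*} [NormedAddCommGroup X] [NormedSpace ℝ X]
    {A B : (𝔼 n) →L[ℝ] X} (h : ∀ i, A 𝐞[i] = B 𝐞[i]) : A = B := by
  ext v
  rw [← sum_smul_single v]
  simp only [map_sum, map_smul, h]

end StandardBasis

section Charts

variable {n m : ℕ} {M : Type*} [TopologicalSpace M] [ChartedSpace (𝔼 n) M]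
  {N : Type*} [TopologicalSpace N] [ChartedSpace (𝔼 m) N]

/-- The differential of the inverse of the chart at `p`, at the point with coordinates `y`: it sends
the `i`-th standard basis vector to the coordinate vector field `coordVec p i y`. -/
def coordFrame (p : M) (y : 𝔼 n) :
    (𝔼 n) →L[ℝ] TangentSpace (𝓡 n) ((extChartAt (𝓡 n) p).symm y) :=
  mfderiv 𝓘(ℝ, 𝔼 n) (𝓡 n) (extChartAt (𝓡 n) p).symm y

/-- The expression of a map in the charts at `p` and `q`. -/
def localRep (p : M) (q : N) (f : M → N) (y : 𝔼 n) : 𝔼 m :=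
  extChartAt (𝓡 m) q (f ((extChartAt (𝓡 n) p).symm y))

/-- The expression in the chart at `p` of a field of bilinear forms. -/
def chartForm (φ : Tensor2 n M) (p : M) (y : 𝔼 n) : (𝔼 n) →L[ℝ] (𝔼 n) →L[ℝ] ℝ :=
  LinearMap.toContinuousBilinearMap
    ((φ ((extChartAt (𝓡 n) p).symm y)).compl₁₂
      (coordFrame p y : (𝔼 n) →ₗ[ℝ] TangentSpace (𝓡 n) ((extChartAt (𝓡 n) p).symm y))
      (coordFrame p y : (𝔼 n) →ₗ[ℝ] TangentSpace (𝓡 n) ((extChartAt (𝓡 n) p).symm y)))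

theorem coeff_apply (φ : Tensor2 n M) (p : M) (y : 𝔼 n) (i j : Fin n) :
    coeff φ p y i j = chartForm φ p y 𝐞[i] 𝐞[j] :=
  rfl

theorem tensor2_congr (φ : Tensor2 n M) {x x' : M} (h : x = x') (v w : 𝔼 n) :
    φ x (show TangentSpace (𝓡 n) x from v) (show TangentSpace (𝓡 n) x from w) =
      φ x' (show TangentSpace (𝓡 n) x' from v) (show TangentSpace (𝓡 n) x' from w) := by
  subst h
  rfl

theorem sum_mul_component {x : M} (Y : TangentSpace (𝓡 n) x) (L : (𝔼 n) →L[ℝ] ℝ) :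
    ∑ j, L 𝐞[j] * component x Y j =
      L (mfderiv (𝓡 n) 𝓘(ℝ, 𝔼 n) (extChartAt (𝓡 n) x) x Y) := by
  conv_rhs => rw [← sum_smul_single (mfderiv (𝓡 n) 𝓘(ℝ, 𝔼 n) (extChartAt (𝓡 n) x) x Y)]
  simp only [map_sum, map_smul, smul_eq_mul, mul_comm]
  rfl

variable {p : M} {q : N} {f : M → N} {y : 𝔼 n}

theorem localRep_mem_target (hq : f ((extChartAt (𝓡 n) p).symm y) ∈ (extChartAt (𝓡 m) q).source) :
    localRep p q f y ∈ (extChartAt (𝓡 m) q).target :=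
  (extChartAt (𝓡 m) q).map_source hq

theorem localRep_center {x : M} :
    localRep x (f x) f (extChartAt (𝓡 n) x x) = extChartAt (𝓡 m) (f x) (f x) := by
  rw [localRep, extChartAt_to_inv]

variable [IsManifold (𝓡 n) ∞ M] [IsManifold (𝓡 m) ∞ N]

theorem contMDiffAt_chart_symm (hy : y ∈ (extChartAt (𝓡 n) p).target) :
    ContMDiffAt 𝓘(ℝ, 𝔼 n) (𝓡 n) ∞ (extChartAt (𝓡 n) p).symm y :=
  (contMDiffOn_extChartAt_symm p).contMDiffAt ((isOpen_extChartAt_target p).mem_nhds hy)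

theorem contMDiffAt_chart {x : M} (hx : x ∈ (extChartAt (𝓡 n) p).source) :
    ContMDiffAt (𝓡 n) 𝓘(ℝ, 𝔼 n) ∞ (extChartAt (𝓡 n) p) x :=
  contMDiffAt_extChartAt' (by rwa [extChartAt_source] at hx)

theorem mfderiv_chart_coordFrame (hy : y ∈ (extChartAt (𝓡 n) p).target) (v : 𝔼 n) :
    mfderiv (𝓡 n) 𝓘(ℝ, 𝔼 n) (extChartAt (𝓡 n) p) ((extChartAt (𝓡 n) p).symm y)
      (coordFrame p y v) = v := by
  have := mfderiv_extChartAt_comp_mfderivWithin_extChartAt_symm hy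
  rw [(𝓡 n).range_eq_univ, mfderivWithin_univ] at this
  exact DFunLike.congr_fun this v

theorem coordFrame_mfderiv_chart {x : M} (hx : x ∈ (extChartAt (𝓡 n) p).source)
    (Y : TangentSpace (𝓡 n) x) :
    coordFrame p (extChartAt (𝓡 n) p x)
      (mfderiv (𝓡 n) 𝓘(ℝ, 𝔼 n) (extChartAt (𝓡 n) p) x Y) = Y := by
  have := mfderivWithin_extChartAt_symm_comp_mfderiv_extChartAt' (I := 𝓡 n) hx
  rw [(𝓡 n).range_eq_univ, mfderivWithin_univ] at this
  exact DFunLike.congr_fun this Y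

theorem coordFrame_ne_zero (hy : y ∈ (extChartAt (𝓡 n) p).target) {v : 𝔼 n} (hv : v ≠ 0) :
    coordFrame p y v ≠ 0 := fun h0 =>
  hv <| by rw [← mfderiv_chart_coordFrame hy v, h0]; exact map_zero _

theorem contDiffAt_localRep (hy : y ∈ (extChartAt (𝓡 n) p).target)
    (hf : ContMDiffAt (𝓡 n) (𝓡 m) ∞ f ((extChartAt (𝓡 n) p).symm y))
    (hq : f ((extChartAt (𝓡 n) p).symm y) ∈ (extChartAt (𝓡 m) q).source) :
    ContDiffAt ℝ ∞ (localRep p q f : (𝔼 n) → 𝔼 m) y := by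
  rw [← contMDiffAt_iff_contDiffAt]
  exact (contMDiffAt_chart hq).comp y (hf.comp y (contMDiffAt_chart_symm hy))

theorem contDiffAt_localRep_center {x : M} (hf : ContMDiffAt (𝓡 n) (𝓡 m) ∞ f x) :
    ContDiffAt ℝ ∞ (localRep x (f x) f : (𝔼 n) → 𝔼 m) (extChartAt (𝓡 n) x x) :=
  contDiffAt_localRep (mem_extChartAt_target x) (by rwa [extChartAt_to_inv])
    (by rw [extChartAt_to_inv]; exact mem_extChartAt_source (f x))

theorem mfderiv_coordFrame (hy : y ∈ (extChartAt (𝓡 n) p).target)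
    (hf : ContMDiffAt (𝓡 n) (𝓡 m) ∞ f ((extChartAt (𝓡 n) p).symm y))
    (hq : f ((extChartAt (𝓡 n) p).symm y) ∈ (extChartAt (𝓡 m) q).source) (v : 𝔼 n) :
    (mfderiv (𝓡 n) (𝓡 m) f ((extChartAt (𝓡 n) p).symm y) (coordFrame p y v) : 𝔼 m) =
      coordFrame q (localRep p q f y) (fderiv ℝ (localRep p q f) y v) := by
  have hs := contMDiffAt_chart_symm hy
  have hfs := mfderiv_comp y (hf.mdifferentiableAt (by simp)) (hs.mdifferentiableAt (by simp))
  have hsu := mfderiv_comp y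
    ((contMDiffAt_chart_symm (localRep_mem_target hq)).mdifferentiableAt (by simp))
    ((contDiffAt_localRep hy hf hq).contMDiffAt.mdifferentiableAt (by simp))
  have heq : f ∘ (extChartAt (𝓡 n) p).symm =ᶠ[𝓝 y]
      (extChartAt (𝓡 m) q).symm ∘ localRep p q f := by
    filter_upwards [(hf.comp y hs).continuousAt.preimage_mem_nhds
      ((isOpen_extChartAt_source q).mem_nhds hq)] with z hz
    exact ((extChartAt (𝓡 m) q).left_inv hz).symm
  rw [mfderiv_eq_fderiv] at hsu
  exact ((DFunLike.congr_fun hfs v).symm.trans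
    (congrArg (fun L : (𝔼 n) →L[ℝ] 𝔼 m => L v) heq.mfderiv_eq)).trans (DFunLike.congr_fun hsu v)

theorem chartForm_pullback (φ : Tensor2 m N) (hy : y ∈ (extChartAt (𝓡 n) p).target)
    (hf : ContMDiffAt (𝓡 n) (𝓡 m) ∞ f ((extChartAt (𝓡 n) p).symm y))
    (hq : f ((extChartAt (𝓡 n) p).symm y) ∈ (extChartAt (𝓡 m) q).source) (v w : 𝔼 n) :
    φ (f ((extChartAt (𝓡 n) p).symm y))
        (mfderiv (𝓡 n) (𝓡 m) f ((extChartAt (𝓡 n) p).symm y) (coordFrame p y v))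
        (mfderiv (𝓡 n) (𝓡 m) f ((extChartAt (𝓡 n) p).symm y) (coordFrame p y w)) =
      chartForm φ q (localRep p q f y) (fderiv ℝ (localRep p q f) y v)
        (fderiv ℝ (localRep p q f) y w) := by
  refine (tensor2_congr φ ((extChartAt (𝓡 m) q).left_inv hq).symm _ _).trans ?_
  exact congrArg₂ (fun a b => φ ((extChartAt (𝓡 m) q).symm (localRep p q f y)) a b)
    (mfderiv_coordFrame hy hf hq v) (mfderiv_coordFrame hy hf hq w)

theorem chartForm_pullbackMetric (h : Metric m N) (hy : y ∈ (extChartAt (𝓡 n) p).target)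
    (hf : ContMDiffAt (𝓡 n) (𝓡 m) ∞ f ((extChartAt (𝓡 n) p).symm y))
    (hq : f ((extChartAt (𝓡 n) p).symm y) ∈ (extChartAt (𝓡 m) q).source) (v w : 𝔼 n) :
    chartForm (pullbackMetric h f) p y v w =
      chartForm (metricTensor h) q (localRep p q f y) (fderiv ℝ (localRep p q f) y v)
        (fderiv ℝ (localRep p q f) y w) :=
  chartForm_pullback (metricTensor h) hy hf hq v w

theorem chartForm_transition (φ : Tensor2 n M) {p' : M} (hy : y ∈ (extChartAt (𝓡 n) p).target)
    (hp' : (extChartAt (𝓡 n) p).symm y ∈ (extChartAt (𝓡 n) p').source) (v w : 𝔼 n) :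
    chartForm φ p y v w =
      chartForm φ p' (localRep p p' id y) (fderiv ℝ (localRep p p' (id : M → M)) y v)
        (fderiv ℝ (localRep p p' (id : M → M)) y w) := by
  rw [← chartForm_pullback φ hy contMDiffAt_id hp', mfderiv_id]
  rfl

end Charts

section MetricInCharts

variable {n : ℕ} {M : Type*} [TopologicalSpace M] [ChartedSpace (𝔼 n) M] [IsManifold (𝓡 n) ∞ M]
  (g : Metric n M) {p : M} {y : 𝔼 n}

theorem chartForm_metric_symm (p : M) (y v w : 𝔼 n) :
    chartForm (metricTensor g) p y v w = chartForm (metricTensor g) p y w v :=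
  g.symm _ _ _

theorem chartForm_metric_pos (hy : y ∈ (extChartAt (𝓡 n) p).target) {v : 𝔼 n} (hv : v ≠ 0) :
    0 < chartForm (metricTensor g) p y v v :=
  g.pos _ _ (coordFrame_ne_zero hy hv)

theorem chartForm_metric_ext (hy : y ∈ (extChartAt (𝓡 n) p).target) {v w : 𝔼 n}
    (h : ∀ x, chartForm (metricTensor g) p y v x = chartForm (metricTensor g) p y w x) :
    v = w := by
  by_contra hne
  refine (chartForm_metric_pos g hy (sub_ne_zero.2 hne)).ne' ?_
  rw [map_sub (chartForm (metricTensor g) p y), sub_apply, h, sub_self]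

theorem contMDiffAt_coordFrame_apply (hy : y ∈ (extChartAt (𝓡 n) p).target) (v : 𝔼 n) :
    ContMDiffAt 𝓘(ℝ, 𝔼 n) ((𝓡 n).prod 𝓘(ℝ, 𝔼 n)) ∞
      (fun z => TotalSpace.mk' (𝔼 n) (E := fun x : M => TangentSpace (𝓡 n) x)
        ((extChartAt (𝓡 n) p).symm z) (coordFrame p z v)) y := by
  have hT := isOpen_extChartAt_target (I := 𝓡 n) p
  have hmap := (contMDiffOn_extChartAt_symm (I := 𝓡 n) (n := ∞) p).contMDiffOn_tangentMapWithin
    (m := ∞) (by simp) hT.uniqueMDiffOn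
  have hconst := (contMDiffAt_vectorSpace_iff_contDiffAt (𝕜 := ℝ) (n := ∞) (x := y)
    (V := fun _ : 𝔼 n => v)).2 contDiffAt_const
  have hcomp : ContMDiffWithinAt 𝓘(ℝ, 𝔼 n) ((𝓡 n).tangent) ∞
      (fun z => tangentMapWithin 𝓘(ℝ, 𝔼 n) (𝓡 n) (extChartAt (𝓡 n) p).symm
        (extChartAt (𝓡 n) p).target (⟨z, v⟩ : TangentBundle 𝓘(ℝ, 𝔼 n) (𝔼 n)))
      (extChartAt (𝓡 n) p).target y :=
    (hmap ⟨y, v⟩ hy).comp y hconst.contMDiffWithinAt fun z hz => hz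
  refine (hcomp.contMDiffAt (hT.mem_nhds hy)).congr_of_eventuallyEq ?_
  filter_upwards [hT.mem_nhds hy] with z hz
  simp only [tangentMapWithin, coordFrame, mfderivWithin_of_isOpen hT hz]
  rfl

theorem contDiffOn_chartForm_metric (p : M) :
    ContDiffOn ℝ ∞ (chartForm (metricTensor g) p) (extChartAt (𝓡 n) p).target := by
  refine contDiffOn_clm_apply.2 fun v => contDiffOn_clm_apply.2 fun w y hy => ?_
  refine ContDiffAt.contDiffWithinAt ?_
  rw [← contMDiffAt_iff_contDiffAt]
  have hinner : ContMDiffAt 𝓘(ℝ, 𝔼 n) ((𝓡 n).prod 𝓘(ℝ)) ∞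
      (fun z => TotalSpace.mk' ℝ (E := Bundle.Trivial M ℝ) ((extChartAt (𝓡 n) p).symm z)
        (g.inner ((extChartAt (𝓡 n) p).symm z) (coordFrame p z v) (coordFrame p z w))) y := by
    apply ContMDiffAt.clm_bundle_apply₂ (F₁ := 𝔼 n) (F₂ := 𝔼 n)
    · exact (g.contMDiff _).comp y (contMDiffAt_chart_symm hy)
    · exact contMDiffAt_coordFrame_apply hy v
    · exact contMDiffAt_coordFrame_apply hy w
  simp only [contMDiffAt_totalSpace] at hinner
  exact hinner.2

variable {g}

theorem contDiffAt_chartForm_metric (hy : y ∈ (extChartAt (𝓡 n) p).target) :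
    ContDiffAt ℝ ∞ (chartForm (metricTensor g) p) y :=
  (contDiffOn_chartForm_metric g p).contDiffAt ((isOpen_extChartAt_target p).mem_nhds hy)

theorem contDiffAt_coeff_metric (hy : y ∈ (extChartAt (𝓡 n) p).target) (i j : Fin n) :
    ContDiffAt ℝ ∞ (fun z => coeff (metricTensor g) p z i j) y :=
  ((contDiffAt_chartForm_metric hy).clm_apply contDiffAt_const).clm_apply contDiffAt_const

theorem coeff_metric_posDef (hy : y ∈ (extChartAt (𝓡 n) p).target) :
    (coeff (metricTensor g) p y).PosDef := by
  refine Matrix.PosDef.of_dotProduct_mulVec_pos ?_ fun s hs => ?_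
  · ext i j
    exact chartForm_metric_symm g p y 𝐞[j] 𝐞[i]
  · have hne : WithLp.toLp 2 s ≠ 0 := fun h0 => hs (by simpa using h0)
    refine (chartForm_metric_pos g hy hne).trans_eq ?_
    rw [bilin_eq_sum]
    simp only [dotProduct, Matrix.mulVec, Finset.mul_sum, star_trivial, coeff_apply]

theorem coeff_metric_det_pos (hy : y ∈ (extChartAt (𝓡 n) p).target) :
    0 < (coeff (metricTensor g) p y).det :=
  (coeff_metric_posDef hy).det_pos

theorem contDiffAt_invCoeff (hy : y ∈ (extChartAt (𝓡 n) p).target) (i j : Fin n) :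
    ContDiffAt ℝ ∞ (fun z => invCoeff g p z i j) y :=
  contDiffAt_inv_entry (contDiffAt_coeff_metric hy) (coeff_metric_det_pos hy).ne' i j

theorem invCoeff_symm (p : M) (y : 𝔼 n) (i j : Fin n) :
    invCoeff g p y i j = invCoeff g p y j i := by
  have hcoeff : (coeff (metricTensor g) p y).transpose = coeff (metricTensor g) p y :=
    Matrix.ext fun i j => chartForm_metric_symm g p y 𝐞[j] 𝐞[i]
  rw [← Matrix.transpose_apply (invCoeff g p y), invCoeff, Matrix.transpose_nonsing_inv, hcoeff]

end MetricInCharts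

section Congruence

variable {n : ℕ} {M : Type*} [TopologicalSpace M] [ChartedSpace (𝔼 n) M]

theorem matrix_bilin_left (B : (𝔼 n) →L[ℝ] (𝔼 n) →L[ℝ] ℝ) (T : (𝔼 n) →ₗ[ℝ] 𝔼 n)
    (w : Fin n → 𝔼 n) :
    (Matrix.of fun i j => B (T 𝐞[i]) (w j)) =
      (Matrix.of fun a i => T 𝐞[i] a).transpose * Matrix.of fun a j => B 𝐞[a] (w j) := by
  ext i j
  rw [Matrix.of_apply, ← sum_smul_single (T 𝐞[i])]
  simp [Matrix.mul_apply, map_sum, sum_apply]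

theorem matrix_bilin_right (B : (𝔼 n) →L[ℝ] (𝔼 n) →L[ℝ] ℝ) (T : (𝔼 n) →ₗ[ℝ] 𝔼 n)
    (v : Fin n → 𝔼 n) :
    (Matrix.of fun i j => B (v i) (T 𝐞[j])) =
      (Matrix.of fun i b => B (v i) 𝐞[b]) * Matrix.of fun b j => T 𝐞[j] b := by
  ext i j
  rw [Matrix.of_apply, ← sum_smul_single (T 𝐞[j])]
  simp [Matrix.mul_apply, map_sum, mul_comm]

theorem trace_inv_mul_transpose_congr {ι : Type*} [Fintype ι] [DecidableEq ι]
    {J G B : Matrix ι ι ℝ} (hJ : IsUnit J.det) :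
    ((J.transpose * G * J)⁻¹ * (J.transpose * B * J).transpose).trace =
      (G⁻¹ * B.transpose).trace := by
  have hJt : IsUnit J.transpose.det := by rwa [Matrix.det_transpose]
  have hcancel : (J.transpose * G * J)⁻¹ * (J.transpose * B * J).transpose =
      J⁻¹ * (G⁻¹ * B.transpose * J) := by
    rw [Matrix.mul_inv_rev, Matrix.mul_inv_rev, Matrix.transpose_mul, Matrix.transpose_mul,
      Matrix.transpose_transpose]
    simp only [Matrix.mul_assoc]
    rw [Matrix.nonsing_inv_mul_cancel_left _ _ hJt]
  rw [hcancel, Matrix.trace_mul_comm, Matrix.mul_nonsing_inv_cancel_right _ _ hJ]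

/-- The Jacobian matrix of the change of charts from `p` to `p'`. -/
def transitionJacobian (p p' : M) (y : 𝔼 n) : Matrix (Fin n) (Fin n) ℝ :=
  Matrix.of fun a i => fderiv ℝ (localRep p p' (id : M → M)) y 𝐞[i] a

theorem matrix_bilin_transition (p p' : M) (y : 𝔼 n) (B : (𝔼 n) →L[ℝ] (𝔼 n) →L[ℝ] ℝ) :
    (Matrix.of fun i j => B (fderiv ℝ (localRep p p' (id : M → M)) y 𝐞[i])
      (fderiv ℝ (localRep p p' (id : M → M)) y 𝐞[j])) =
      (transitionJacobian p p' y).transpose * (Matrix.of fun a b => B 𝐞[a] 𝐞[b]) *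
        transitionJacobian p p' y :=
  (matrix_bilin_left B (fderiv ℝ (localRep p p' (id : M → M)) y).toLinearMap _).trans <| by
    rw [Matrix.mul_assoc]
    exact congrArg _ (matrix_bilin_right B (fderiv ℝ (localRep p p' (id : M → M)) y).toLinearMap _)

end Congruence

section Trace

variable {n : ℕ} {M : Type*} [TopologicalSpace M] [ChartedSpace (𝔼 n) M] [IsManifold (𝓡 n) ∞ M]
  {X : Type*} [AddCommGroup X] [Module ℝ X] {g : Metric n M} {p : M} {y : 𝔼 n}

/-- The trace `∑ gⁱʲ B(∂ᵢ, ∂ⱼ)` with respect to the metric, at the point with coordinates `y` in the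
chart at `p`, of a possibly vector-valued bilinear map `B`. -/
def coordTrace (g : Metric n M) (p : M) (y : 𝔼 n) (B : (𝔼 n) → (𝔼 n) → X) : X :=
  ∑ i, ∑ j, invCoeff g p y i j • B 𝐞[i] 𝐞[j]

theorem coordTrace_add (B C : (𝔼 n) → (𝔼 n) → X) :
    coordTrace g p y (fun v w => B v w + C v w) = coordTrace g p y B + coordTrace g p y C := by
  simp only [coordTrace, smul_add, Finset.sum_add_distrib]

theorem coordTrace_sub (B C : (𝔼 n) → (𝔼 n) → X) :
    coordTrace g p y (fun v w => B v w - C v w) = coordTrace g p y B - coordTrace g p y C := by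
  simp only [coordTrace, smul_sub, Finset.sum_sub_distrib]

theorem coordTrace_swap (B : (𝔼 n) → (𝔼 n) → X) :
    coordTrace g p y (fun v w => B w v) = coordTrace g p y B := by
  rw [coordTrace, Finset.sum_comm]
  exact Finset.sum_congr rfl fun i _ => Finset.sum_congr rfl fun j _ => by rw [invCoeff_symm]

theorem map_coordTrace {Y : Type*} [AddCommGroup Y] [Module ℝ Y] (L : X →ₗ[ℝ] Y)
    (B : (𝔼 n) → (𝔼 n) → X) :
    L (coordTrace g p y B) = coordTrace g p y fun v w => L (B v w) := by
  simp only [coordTrace, map_sum, map_smul]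

theorem coordTrace_eq_trace (B : (𝔼 n) → (𝔼 n) → ℝ) :
    coordTrace g p y B =
      (invCoeff g p y * (Matrix.of fun i j => B 𝐞[i] 𝐞[j]).transpose).trace := by
  simp only [coordTrace, Matrix.trace, Matrix.diag_apply, Matrix.mul_apply,
    Matrix.transpose_apply, Matrix.of_apply, smul_eq_mul]

variable {p' : M}

theorem coeff_transition (φ : Tensor2 n M) (hy : y ∈ (extChartAt (𝓡 n) p).target)
    (hp' : (extChartAt (𝓡 n) p).symm y ∈ (extChartAt (𝓡 n) p').source) :
    coeff φ p y = (transitionJacobian p p' y).transpose *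
      coeff φ p' (localRep p p' (id : M → M) y) * transitionJacobian p p' y :=
  (Matrix.ext fun i j => chartForm_transition φ hy hp' 𝐞[i] 𝐞[j]).trans
    (matrix_bilin_transition p p' y (chartForm φ p' (localRep p p' id y)))

theorem isUnit_det_transitionJacobian (g : Metric n M) (hy : y ∈ (extChartAt (𝓡 n) p).target)
    (hp' : (extChartAt (𝓡 n) p).symm y ∈ (extChartAt (𝓡 n) p').source) :
    IsUnit (transitionJacobian p p' y).det := by
  have hdet := (coeff_metric_det_pos (g := g) hy).ne'
  rw [coeff_transition _ hy hp', Matrix.det_mul] at hdet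
  exact isUnit_iff_ne_zero.2 (right_ne_zero_of_mul hdet)

theorem coordTrace_transition (hy : y ∈ (extChartAt (𝓡 n) p).target)
    (hp' : (extChartAt (𝓡 n) p).symm y ∈ (extChartAt (𝓡 n) p').source)
    (B : (𝔼 n) →L[ℝ] (𝔼 n) →L[ℝ] ℝ) :
    coordTrace g p y (fun v w => B (fderiv ℝ (localRep p p' (id : M → M)) y v)
        (fderiv ℝ (localRep p p' (id : M → M)) y w)) =
      coordTrace g p' (localRep p p' (id : M → M) y) fun v w => B v w := by
  rw [coordTrace_eq_trace, coordTrace_eq_trace, matrix_bilin_transition p p' y B, invCoeff,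
    invCoeff, coeff_transition _ hy hp']
  exact trace_inv_mul_transpose_congr (isUnit_det_transitionJacobian g hy hp')

theorem traceMetric_eq_coordTrace (φ : Tensor2 n M) {x : M}
    (hx : x ∈ (extChartAt (𝓡 n) p).source) :
    traceMetric g φ x =
      coordTrace g p (extChartAt (𝓡 n) p x)
        fun v w => chartForm φ p (extChartAt (𝓡 n) p x) v w := by
  have hy := (extChartAt (𝓡 n) p).map_source hx
  have hsymm := (extChartAt (𝓡 n) p).left_inv hx
  have hx' : (extChartAt (𝓡 n) p).symm (extChartAt (𝓡 n) p x) ∈ (extChartAt (𝓡 n) x).source := by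
    rw [hsymm]
    exact mem_extChartAt_source x
  simp only [chartForm_transition φ hy hx', coordTrace_transition hy hx', localRep, hsymm]
  rfl

end Trace

section LeviCivita

variable {n : ℕ} {M : Type*} [TopologicalSpace M] [ChartedSpace (𝔼 n) M] [IsManifold (𝓡 n) ∞ M]
  {g : Metric n M} {p : M} {y : 𝔼 n}

/-- The vector dual to a covector with respect to the metric, in the chart at `p`. -/
def raise (g : Metric n M) (p : M) (y : 𝔼 n) : ((𝔼 n) →L[ℝ] ℝ) →L[ℝ] 𝔼 n :=
  ∑ k, ∑ l, invCoeff g p y k l • (ContinuousLinearMap.apply ℝ ℝ 𝐞[l]).smulRight 𝐞[k]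

theorem raise_apply (α : (𝔼 n) →L[ℝ] ℝ) (k : Fin n) :
    raise g p y α k = ∑ l, invCoeff g p y k l * α 𝐞[l] := by
  simp [raise, Finset.sum_apply, Pi.single_apply]

theorem chartForm_raise (hy : y ∈ (extChartAt (𝓡 n) p).target) (α : (𝔼 n) →L[ℝ] ℝ) :
    chartForm (metricTensor g) p y (raise g p y α) = α := by
  refine clm_ext_single fun j => ?_
  have hinv : coeff (metricTensor g) p y * invCoeff g p y = 1 :=
    Matrix.mul_nonsing_inv _ (coeff_metric_det_pos hy).ne'.isUnit
  calc chartForm (metricTensor g) p y (raise g p y α) 𝐞[j]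
    _ = ∑ k, coeff (metricTensor g) p y j k * ∑ l, invCoeff g p y k l * α 𝐞[l] := by
        rw [chartForm_metric_symm, ← sum_smul_single (raise g p y α)]
        simp only [map_sum, map_smul, smul_eq_mul, raise_apply, coeff_apply, mul_comm]
    _ = ∑ l, (coeff (metricTensor g) p y * invCoeff g p y) j l * α 𝐞[l] := by
        simp only [Matrix.mul_apply, Finset.mul_sum, Finset.sum_mul, mul_assoc]
        exact Finset.sum_comm
    _ = α 𝐞[j] := by simp [hinv, Matrix.one_apply]

section Koszul

variable {E : Type*} [NormedAddCommGroup E] [NormedSpace ℝ E] (D : E →L[ℝ] E →L[ℝ] E →L[ℝ] ℝ)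

/-- Half the right-hand side of the Koszul formula for constant vector fields, where `D` is the
derivative of the metric. -/
def koszulForm (v w : E) : E →L[ℝ] ℝ :=
  (1 / 2 : ℝ) • (D v w + D w v - (D.flip v).flip w)

theorem koszulForm_apply (v w x : E) :
    koszulForm D v w x = 1 / 2 * (D v w x + D w v x - D x v w) :=
  rfl

theorem koszulForm_add_left (v v' w : E) :
    koszulForm D (v + v') w = koszulForm D v w + koszulForm D v' w := by
  ext x
  simp only [koszulForm_apply, ContinuousLinearMap.map_add, add_apply]
  ring

theorem koszulForm_smul_left (c : ℝ) (v w : E) :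
    koszulForm D (c • v) w = c • koszulForm D v w := by
  ext x
  simp only [koszulForm_apply, ContinuousLinearMap.map_smul, smul_apply, smul_eq_mul]
  ring

theorem koszulForm_add_right (v w w' : E) :
    koszulForm D v (w + w') = koszulForm D v w + koszulForm D v w' := by
  ext x
  simp only [koszulForm_apply, ContinuousLinearMap.map_add, add_apply]
  ring

theorem koszulForm_smul_right (c : ℝ) (v w : E) :
    koszulForm D v (c • w) = c • koszulForm D v w := by
  ext x
  simp only [koszulForm_apply, ContinuousLinearMap.map_smul, smul_apply, smul_eq_mul]
  ring

end Koszul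

set_option synthInstance.maxHeartbeats 100000 in
-- Normed-space instances on `(𝔼 n) →L[ℝ] (𝔼 n) →L[ℝ] ℝ` are slow to synthesize.
/-- The Levi-Civita connection in the chart at `p`: `Γ(v, w) = ∇_v w` for constant vector fields
`v` and `w`. -/
def christoffelForm (g : Metric n M) (p : M) (y : 𝔼 n) : (𝔼 n) →ₗ[ℝ] (𝔼 n) →ₗ[ℝ] 𝔼 n :=
  LinearMap.mk₂ ℝ
    (fun v w => raise g p y (koszulForm (fderiv ℝ (chartForm (metricTensor g) p) y) v w))
    (fun _ _ _ => by rw [koszulForm_add_left, map_add])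
    (fun _ _ _ => by rw [koszulForm_smul_left, map_smul])
    (fun _ _ _ => by rw [koszulForm_add_right, map_add])
    (fun _ _ _ => by rw [koszulForm_smul_right, map_smul])

theorem chartForm_christoffelForm (hy : y ∈ (extChartAt (𝓡 n) p).target) (v w x : 𝔼 n) :
    chartForm (metricTensor g) p y (christoffelForm g p y v w) x =
      koszulForm (fderiv ℝ (chartForm (metricTensor g) p) y) v w x :=
  DFunLike.congr_fun (chartForm_raise hy _) x

theorem differentiableAt_chartForm_metric (hy : y ∈ (extChartAt (𝓡 n) p).target) :
    DifferentiableAt ℝ (chartForm (metricTensor g) p) y :=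
  (contDiffAt_chartForm_metric hy).differentiableAt (by simp)

theorem fderiv_chartForm_metric_symm (hy : y ∈ (extChartAt (𝓡 n) p).target) (x v w : 𝔼 n) :
    fderiv ℝ (chartForm (metricTensor g) p) y x v w =
      fderiv ℝ (chartForm (metricTensor g) p) y x w v := by
  rw [fderiv_bilin_apply (differentiableAt_chartForm_metric hy),
    fderiv_bilin_apply (differentiableAt_chartForm_metric hy)]
  simp only [chartForm_metric_symm g p _ v w]

theorem christoffelForm_symm (hy : y ∈ (extChartAt (𝓡 n) p).target) (v w : 𝔼 n) :
    christoffelForm g p y v w = christoffelForm g p y w v := by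
  refine chartForm_metric_ext g hy fun x => ?_
  rw [chartForm_christoffelForm hy, chartForm_christoffelForm hy, koszulForm_apply,
    koszulForm_apply, fderiv_chartForm_metric_symm hy x v w]
  ring

theorem fderiv_chartForm_metric (hy : y ∈ (extChartAt (𝓡 n) p).target) (x v w : 𝔼 n) :
    fderiv ℝ (chartForm (metricTensor g) p) y x v w =
      chartForm (metricTensor g) p y (christoffelForm g p y x v) w +
        chartForm (metricTensor g) p y v (christoffelForm g p y x w) := by
  rw [chartForm_metric_symm g p y v, chartForm_christoffelForm hy, chartForm_christoffelForm hy,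
    koszulForm_apply, koszulForm_apply]
  linarith [fderiv_chartForm_metric_symm (g := g) hy x v w,
    fderiv_chartForm_metric_symm (g := g) hy v x w, fderiv_chartForm_metric_symm (g := g) hy w x v]

theorem christoffelForm_single (hy : y ∈ (extChartAt (𝓡 n) p).target) (i j k : Fin n) :
    christoffelForm g p y 𝐞[i] 𝐞[j] k = christoffel g p k i j y := by
  refine (raise_apply _ k).trans ?_
  simp only [koszulForm_apply, fderiv_bilin_apply (differentiableAt_chartForm_metric hy),
    christoffel, pd, coeff_apply, Finset.mul_sum]
  exact Finset.sum_congr rfl fun l _ => by ring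

end LeviCivita

section MetricDerivatives

variable {n : ℕ} {M : Type*} [TopologicalSpace M] [ChartedSpace (𝔼 n) M] [IsManifold (𝓡 n) ∞ M]
  {g : Metric n M} {p : M} {y : 𝔼 n}

/-- The matrix of the endomorphism `w ↦ ∇_v w` given by the Levi-Civita connection in the chart
at `p`. -/
def connectionMatrix (g : Metric n M) (p : M) (y v : 𝔼 n) : Matrix (Fin n) (Fin n) ℝ :=
  Matrix.of fun a i => christoffelForm g p y v 𝐞[i] a

theorem entryDeriv_coeff_metric (hy : y ∈ (extChartAt (𝓡 n) p).target) (v : 𝔼 n) :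
    entryDeriv (coeff (metricTensor g) p) y v =
      (connectionMatrix g p y v).transpose * coeff (metricTensor g) p y +
        coeff (metricTensor g) p y * connectionMatrix g p y v := by
  calc entryDeriv (coeff (metricTensor g) p) y v
    _ = (Matrix.of fun i j =>
          chartForm (metricTensor g) p y (christoffelForm g p y v 𝐞[i]) 𝐞[j]) +
        Matrix.of fun i j =>
          chartForm (metricTensor g) p y 𝐞[i] (christoffelForm g p y v 𝐞[j]) := by
        ext i j
        refine (fderiv_bilin_apply (differentiableAt_chartForm_metric hy) v _ _).symm.trans ?_
        exact fderiv_chartForm_metric hy v _ _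
    _ = _ := congrArg₂ _ (matrix_bilin_left _ _ _) (matrix_bilin_right _ _ _)

theorem entryDeriv_invCoeff (hy : y ∈ (extChartAt (𝓡 n) p).target) (v : 𝔼 n) :
    entryDeriv (invCoeff g p) y v =
      -(invCoeff g p y * (connectionMatrix g p y v).transpose +
        connectionMatrix g p y v * invCoeff g p y) := by
  have hdet : IsUnit (coeff (metricTensor g) p y).det := (coeff_metric_det_pos hy).ne'.isUnit
  rw [show invCoeff g p = fun z => (coeff (metricTensor g) p z)⁻¹ from rfl,
    entryDeriv_inv (fun i j => (contDiffAt_coeff_metric hy i j).of_le (by simp)) hdet.ne_zero,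
    entryDeriv_coeff_metric hy]
  simp only [Matrix.mul_add, Matrix.add_mul, Matrix.mul_assoc, Matrix.mul_nonsing_inv _ hdet,
    Matrix.nonsing_inv_mul_cancel_left _ _ hdet, Matrix.mul_one]

theorem differentiableAt_coordTrace (hy : y ∈ (extChartAt (𝓡 n) p).target)
    {P : (𝔼 n) → (𝔼 n) → (𝔼 n) → ℝ} (hP : ∀ v w, DifferentiableAt ℝ (fun z => P z v w) y) :
    DifferentiableAt ℝ (fun z => coordTrace g p z (P z)) y :=
  DifferentiableAt.fun_sum fun i _ => DifferentiableAt.fun_sum fun j _ =>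
    ((contDiffAt_invCoeff hy i j).differentiableAt (by simp)).fun_mul (hP _ _)

theorem coordTrace_christoffelForm_left (B : (𝔼 n) →L[ℝ] (𝔼 n) →L[ℝ] ℝ) (x : 𝔼 n) :
    coordTrace g p y (fun v w => B (christoffelForm g p y x v) w) =
      (connectionMatrix g p y x * invCoeff g p y *
        (Matrix.of fun i j => B 𝐞[i] 𝐞[j]).transpose).trace := by
  rw [coordTrace_eq_trace, matrix_bilin_left B (christoffelForm g p y x),
    Matrix.transpose_mul, Matrix.transpose_transpose, Matrix.mul_assoc,
    Matrix.trace_mul_comm (connectionMatrix g p y x), ← Matrix.mul_assoc]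
  rfl

theorem coordTrace_christoffelForm_right (B : (𝔼 n) →L[ℝ] (𝔼 n) →L[ℝ] ℝ) (x : 𝔼 n) :
    coordTrace g p y (fun v w => B v (christoffelForm g p y x w)) =
      (invCoeff g p y * (connectionMatrix g p y x).transpose *
        (Matrix.of fun i j => B 𝐞[i] 𝐞[j]).transpose).trace := by
  rw [coordTrace_eq_trace, matrix_bilin_right B (christoffelForm g p y x), Matrix.mul_assoc,
    Matrix.transpose_mul]
  rfl

theorem fderiv_coordTrace_eq_trace_entryDeriv_add (hy : y ∈ (extChartAt (𝓡 n) p).target)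
    {P : (𝔼 n) → (𝔼 n) → (𝔼 n) → ℝ} (hP : ∀ v w, DifferentiableAt ℝ (fun z => P z v w) y)
    (x : 𝔼 n) :
    fderiv ℝ (fun z => coordTrace g p z (P z)) y x =
      (entryDeriv (invCoeff g p) y x * (Matrix.of fun i j => P y 𝐞[i] 𝐞[j]).transpose).trace +
        coordTrace g p y fun v w => fderiv ℝ (fun z => P z v w) y x := by
  have hg i j := (contDiffAt_invCoeff (g := g) hy i j).differentiableAt (by simp)
  simp only [coordTrace, smul_eq_mul]
  rw [fderiv_fun_sum fun i _ => DifferentiableAt.fun_sum fun j _ => (hg i j).fun_mul (hP _ _)]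
  simp only [sum_apply, fderiv_fun_sum fun j _ => (hg _ j).fun_mul (hP _ _),
    fderiv_fun_mul (hg _ _) (hP _ _), add_apply, smul_apply, smul_eq_mul, Matrix.trace,
    Matrix.diag_apply, Matrix.mul_apply, Matrix.transpose_apply, Matrix.of_apply, entryDeriv,
    ← Finset.sum_add_distrib]
  exact Finset.sum_congr rfl fun i _ => Finset.sum_congr rfl fun j _ => by ring

theorem fderiv_coordTrace (hy : y ∈ (extChartAt (𝓡 n) p).target)
    {P : (𝔼 n) → (𝔼 n) →L[ℝ] (𝔼 n) →L[ℝ] ℝ}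
    (hP : ∀ v w, DifferentiableAt ℝ (fun z => P z v w) y) (x : 𝔼 n) :
    fderiv ℝ (fun z => coordTrace g p z fun v w => P z v w) y x =
      coordTrace g p y fun v w => fderiv ℝ (fun z => P z v w) y x -
        P y (christoffelForm g p y x v) w - P y v (christoffelForm g p y x w) := by
  rw [fderiv_coordTrace_eq_trace_entryDeriv_add hy hP, coordTrace_sub, coordTrace_sub,
    coordTrace_christoffelForm_left, coordTrace_christoffelForm_right, entryDeriv_invCoeff hy,
    Matrix.neg_mul, Matrix.add_mul, Matrix.trace_neg, Matrix.trace_add]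
  ring

end MetricDerivatives

section AlongMaps

variable {E : Type*} [NormedAddCommGroup E] [NormedSpace ℝ E] {m : ℕ} {N : Type*}
  [TopologicalSpace N] [ChartedSpace (𝔼 m) N] [IsManifold (𝓡 m) ∞ N] {h : Metric m N} {q : N}
  {u W V : E → 𝔼 m} {y : E}

/-- The covariant derivative in the direction `v` of a vector field `W` along a map `u`, both
written in the chart at `q`. -/
def covDerivAlong (h : Metric m N) (q : N) (u W : E → 𝔼 m) (y v : E) : 𝔼 m :=
  fderiv ℝ W y v + christoffelForm h q (u y) (fderiv ℝ u y v) (W y)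

theorem fderiv_metric_along (hq : u y ∈ (extChartAt (𝓡 m) q).target)
    (hu : DifferentiableAt ℝ u y) (hW : DifferentiableAt ℝ W y) (hV : DifferentiableAt ℝ V y)
    (v : E) :
    fderiv ℝ (fun z => chartForm (metricTensor h) q (u z) (W z) (V z)) y v =
      chartForm (metricTensor h) q (u y) (covDerivAlong h q u W y v) (V y) +
        chartForm (metricTensor h) q (u y) (W y) (covDerivAlong h q u V y v) := by
  rw [fderiv_bilin (differentiableAt_chartForm_metric hq) hu hW hV, fderiv_chartForm_metric hq]
  simp only [covDerivAlong, map_add, add_apply]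
  ring

theorem differentiableAt_fderiv_apply {F : Type*} [NormedAddCommGroup F] [NormedSpace ℝ F]
    {u : E → F} (hu : ContDiffAt ℝ 2 u y) (v : E) :
    DifferentiableAt ℝ (fun z => fderiv ℝ u z v) y :=
  ((hu.fderiv_right (m := 1) le_rfl).differentiableAt one_ne_zero).clm_apply
    (differentiableAt_const v)

theorem fderiv_fderiv_apply (hu : ContDiffAt ℝ 2 u y) (v w : E) :
    fderiv ℝ (fun z => fderiv ℝ u z w) y v = fderiv ℝ (fderiv ℝ u) y v w := by
  rw [fderiv_clm_apply ((hu.fderiv_right (m := 1) le_rfl).differentiableAt one_ne_zero)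
    (differentiableAt_const w)]
  simp

theorem covDerivAlong_fderiv_comm (hq : u y ∈ (extChartAt (𝓡 m) q).target)
    (hu : ContDiffAt ℝ 2 u y) (v w : E) :
    covDerivAlong h q u (fun z => fderiv ℝ u z w) y v =
      covDerivAlong h q u (fun z => fderiv ℝ u z v) y w := by
  rw [covDerivAlong, covDerivAlong, fderiv_fderiv_apply hu, fderiv_fderiv_apply hu,
    christoffelForm_symm hq, (hu.isSymmSndFDerivAt (by simp)).eq]

end AlongMaps

section SecondFundamentalForm

variable {n m : ℕ} {M : Type*} [TopologicalSpace M] [ChartedSpace (𝔼 n) M] [IsManifold (𝓡 n) ∞ M]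
  {N : Type*} [TopologicalSpace N] [ChartedSpace (𝔼 m) N] [IsManifold (𝓡 m) ∞ N]
  {g : Metric n M} {h : Metric m N} {p : M} {q : N} {u : (𝔼 n) → 𝔼 m} {y : 𝔼 n}

/-- The second fundamental form `(Du_*)(v, w)` of a map `u` written in the charts at `p` and `q`. -/
def secondForm (g : Metric n M) (p : M) (h : Metric m N) (q : N) (u : (𝔼 n) → 𝔼 m)
    (y v w : 𝔼 n) : 𝔼 m :=
  covDerivAlong h q u (fun z => fderiv ℝ u z w) y v - fderiv ℝ u y (christoffelForm g p y v w)

/-- The tension field of a map written in the charts at `p` and `q`. -/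
def tensionCoord (g : Metric n M) (p : M) (h : Metric m N) (q : N) (u : (𝔼 n) → 𝔼 m)
    (y : 𝔼 n) : 𝔼 m :=
  coordTrace g p y (secondForm g p h q u y)

theorem secondForm_symm (hy : y ∈ (extChartAt (𝓡 n) p).target)
    (hq : u y ∈ (extChartAt (𝓡 m) q).target) (hu : ContDiffAt ℝ 2 u y) (v w : 𝔼 n) :
    secondForm g p h q u y v w = secondForm g p h q u y w v := by
  rw [secondForm, secondForm, covDerivAlong_fderiv_comm hq hu, christoffelForm_symm hy]

theorem map_christoffelForm_single {X : Type*} [AddCommGroup X] [Module ℝ X]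
    (hy : y ∈ (extChartAt (𝓡 n) p).target) (A : (𝔼 n) →ₗ[ℝ] X) (i j : Fin n) :
    A (christoffelForm g p y 𝐞[i] 𝐞[j]) = ∑ k, christoffel g p k i j y • A 𝐞[k] := by
  rw [← sum_smul_single (christoffelForm g p y 𝐞[i] 𝐞[j])]
  simp only [map_sum, map_smul, christoffelForm_single hy]

theorem christoffelForm_eq_sum (hy : y ∈ (extChartAt (𝓡 n) p).target) (v w : 𝔼 n) (a : Fin n) :
    christoffelForm g p y v w a = ∑ b, ∑ c, christoffel g p a b c y * v b * w c := by
  conv_lhs => rw [← sum_smul_single v, ← sum_smul_single w]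
  simp only [map_sum, map_smul, LinearMap.sum_apply, LinearMap.smul_apply, WithLp.ofLp_sum,
    Finset.sum_apply, PiLp.smul_apply, christoffelForm_single hy, smul_eq_mul, Finset.mul_sum]
  exact Finset.sum_comm.trans
    (Finset.sum_congr rfl fun b _ => Finset.sum_congr rfl fun c _ => by ring)

theorem fderiv_coord (hu : DifferentiableAt ℝ u y) (a : Fin m) (v : 𝔼 n) :
    fderiv ℝ (fun z => u z a) y v = fderiv ℝ u y v a := by
  have hcomp : HasFDerivAt (fun z => u z a)
      ((EuclideanSpace.proj a : (𝔼 m) →L[ℝ] ℝ).comp (fderiv ℝ u y)) y :=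
    (EuclideanSpace.proj a : (𝔼 m) →L[ℝ] ℝ).hasFDerivAt.comp y hu.hasFDerivAt
  rw [hcomp.fderiv]
  rfl

theorem secondForm_single_apply (hy : y ∈ (extChartAt (𝓡 n) p).target)
    (hq : u y ∈ (extChartAt (𝓡 m) q).target) (hu : ContDiffAt ℝ 2 u y) (a : Fin m) (i j : Fin n) :
    secondForm g p h q u y 𝐞[i] 𝐞[j] a =
      pd i (pd j fun z => u z a) y - ∑ k, christoffel g p k i j y * pd k (fun z => u z a) y +
        ∑ b, ∑ c, christoffel h q a b c (u y) * pd i (fun z => u z b) y *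
          pd j (fun z => u z c) y := by
  have hu1 : DifferentiableAt ℝ u y := hu.differentiableAt (by simp)
  have hdu := differentiableAt_fderiv_apply hu 𝐞[j]
  have hpd : (pd j fun z => u z a) =ᶠ[𝓝 y] fun z => fderiv ℝ u z 𝐞[j] a := by
    filter_upwards [hu.eventually (by simp)] with z hz
    exact fderiv_coord (hz.differentiableAt (by simp)) a _
  have hlin : fderiv ℝ u y (christoffelForm g p y 𝐞[i] 𝐞[j]) a =
      ∑ k, christoffel g p k i j y * pd k (fun z => u z a) y := by
    simp only [pd, fderiv_coord hu1]
    refine (congrArg (fun w : 𝔼 m => w a)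
      (map_christoffelForm_single hy (fderiv ℝ u y).toLinearMap i j)).trans ?_
    simp [Finset.sum_apply]
  rw [secondForm, covDerivAlong, PiLp.sub_apply, PiLp.add_apply, hlin,
    christoffelForm_eq_sum hq, pd, hpd.fderiv_eq, fderiv_coord hdu]
  simp only [pd, fderiv_coord hu1]
  ring

theorem tension_eq_coordFrame {f : M → N} {x : M} (hf : ContMDiffAt (𝓡 n) (𝓡 m) ∞ f x) :
    tension g h f x = (coordFrame (f x) (extChartAt (𝓡 m) (f x) (f x))
      (tensionCoord g x h (f x) (localRep x (f x) f) (extChartAt (𝓡 n) x x)) : 𝔼 m) := by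
  have hx := mem_extChartAt_target (I := 𝓡 n) x
  have hc : localRep x (f x) f (extChartAt (𝓡 n) x x) = extChartAt (𝓡 m) (f x) (f x) :=
    localRep_center
  have hq : localRep x (f x) f (extChartAt (𝓡 n) x x) ∈ (extChartAt (𝓡 m) (f x)).target :=
    hc ▸ mem_extChartAt_target (f x)
  have hu : ContDiffAt ℝ 2 (localRep x (f x) f) (extChartAt (𝓡 n) x x) :=
    (contDiffAt_localRep_center hf).of_le ENat.LEInfty.out
  rw [← sum_smul_single (tensionCoord _ _ _ _ _ _), map_sum, tension]
  refine Finset.sum_congr rfl fun a _ => ?_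
  rw [map_smul]
  congr 1
  simp only [tensionCoord, coordTrace, WithLp.ofLp_sum, Finset.sum_apply, PiLp.smul_apply,
    secondForm_single_apply hx hq hu, smul_eq_mul, hc]
  rfl

end SecondFundamentalForm

section PullbackMetric

variable {n m : ℕ} {M : Type*} [TopologicalSpace M] [ChartedSpace (𝔼 n) M] [IsManifold (𝓡 n) ∞ M]
  {N : Type*} [TopologicalSpace N] [ChartedSpace (𝔼 m) N] [IsManifold (𝓡 m) ∞ N]
  {g : Metric n M} {h : Metric m N} {p : M} {q : N} {f : M → N} {y : 𝔼 n}

theorem covDeriv_eq (φ : Tensor2 n M) (hy : y ∈ (extChartAt (𝓡 n) p).target) (k i j : Fin n) :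
    covDeriv g φ p k i j y =
      fderiv ℝ (fun z => chartForm φ p z 𝐞[i] 𝐞[j]) y 𝐞[k] -
        chartForm φ p y (christoffelForm g p y 𝐞[k] 𝐞[i]) 𝐞[j] -
        chartForm φ p y 𝐞[i] (christoffelForm g p y 𝐞[k] 𝐞[j]) := by
  have hleft := map_christoffelForm_single (g := g) hy ((chartForm φ p y).flip 𝐞[j]).toLinearMap k i
  have hright := map_christoffelForm_single (g := g) hy (chartForm φ p y 𝐞[i]).toLinearMap k j
  exact congrArg₂ _ (congrArg₂ _ rfl hleft.symm) hright.symm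

theorem eventually_chartForm_pullbackMetric (hy : y ∈ (extChartAt (𝓡 n) p).target)
    (hf : ContMDiff (𝓡 n) (𝓡 m) ∞ f)
    (hq : f ((extChartAt (𝓡 n) p).symm y) ∈ (extChartAt (𝓡 m) q).source) :
    ∀ᶠ z in 𝓝 y, ∀ v w, chartForm (pullbackMetric h f) p z v w =
      chartForm (metricTensor h) q (localRep p q f z) (fderiv ℝ (localRep p q f) z v)
        (fderiv ℝ (localRep p q f) z w) := by
  have hs : ContinuousAt (extChartAt (𝓡 n) p).symm y := (contMDiffAt_chart_symm hy).continuousAt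
  filter_upwards [(isOpen_extChartAt_target p).mem_nhds hy,
    (hf.continuous.continuousAt.comp hs).preimage_mem_nhds
      ((isOpen_extChartAt_source q).mem_nhds hq)] with z hz hqz v w
  exact chartForm_pullbackMetric h hz hf.contMDiffAt hqz v w

section

variable (hy : y ∈ (extChartAt (𝓡 n) p).target)
  (hf : ContMDiff (𝓡 n) (𝓡 m) ∞ f)
  (hq : f ((extChartAt (𝓡 n) p).symm y) ∈ (extChartAt (𝓡 m) q).source)

include hy hf hq

theorem differentiableAt_chartForm_pullbackMetric (v w : 𝔼 n) :
    DifferentiableAt ℝ (fun z => chartForm (pullbackMetric h f) p z v w) y := by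
  have hu : ContDiffAt ℝ 2 (localRep p q f) y :=
    (contDiffAt_localRep hy hf.contMDiffAt hq).of_le ENat.LEInfty.out
  have hH : DifferentiableAt ℝ (fun z => chartForm (metricTensor h) q (localRep p q f z)) y :=
    DifferentiableAt.comp (g := chartForm (metricTensor h) q) y
      (differentiableAt_chartForm_metric (localRep_mem_target hq)) (hu.differentiableAt (by simp))
  refine ((hH.clm_apply (differentiableAt_fderiv_apply hu v)).clm_apply
    (differentiableAt_fderiv_apply hu w)).congr_of_eventuallyEq ?_
  filter_upwards [eventually_chartForm_pullbackMetric (h := h) hy hf hq] with z hz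
  exact hz v w

theorem covDeriv_pullbackMetric (x v w : 𝔼 n) :
    fderiv ℝ (fun z => chartForm (pullbackMetric h f) p z v w) y x -
        chartForm (pullbackMetric h f) p y (christoffelForm g p y x v) w -
        chartForm (pullbackMetric h f) p y v (christoffelForm g p y x w) =
      chartForm (metricTensor h) q (localRep p q f y) (secondForm g p h q (localRep p q f) y x v)
          (fderiv ℝ (localRep p q f) y w) +
        chartForm (metricTensor h) q (localRep p q f y) (fderiv ℝ (localRep p q f) y v)
          (secondForm g p h q (localRep p q f) y x w) := by
  have hu : ContDiffAt ℝ 2 (localRep p q f) y :=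
    (contDiffAt_localRep hy hf.contMDiffAt hq).of_le ENat.LEInfty.out
  have hP : (fun z => chartForm (pullbackMetric h f) p z v w) =ᶠ[𝓝 y] fun z =>
      chartForm (metricTensor h) q (localRep p q f z) (fderiv ℝ (localRep p q f) z v)
        (fderiv ℝ (localRep p q f) z w) := by
    filter_upwards [eventually_chartForm_pullbackMetric (h := h) hy hf hq] with z hz
    exact hz v w
  rw [hP.fderiv_eq, chartForm_pullbackMetric h hy hf.contMDiffAt hq,
    chartForm_pullbackMetric h hy hf.contMDiffAt hq,
    fderiv_metric_along (localRep_mem_target hq) (hu.differentiableAt (by simp))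
      (differentiableAt_fderiv_apply hu v) (differentiableAt_fderiv_apply hu w)]
  simp only [secondForm, map_sub, sub_apply]
  ring

theorem fderiv_coordTrace_pullbackMetric (x : 𝔼 n) :
    fderiv ℝ (fun z => coordTrace g p z fun v w => chartForm (pullbackMetric h f) p z v w) y x =
      2 * coordTrace g p y fun v w => chartForm (metricTensor h) q (localRep p q f y)
        (secondForm g p h q (localRep p q f) y v x) (fderiv ℝ (localRep p q f) y w) := by
  have hu : ContDiffAt ℝ 2 (localRep p q f) y :=
    (contDiffAt_localRep hy hf.contMDiffAt hq).of_le ENat.LEInfty.out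
  rw [fderiv_coordTrace hy (differentiableAt_chartForm_pullbackMetric hy hf hq)]
  simp only [covDeriv_pullbackMetric hy hf hq, chartForm_metric_symm h q _ (fderiv ℝ _ y _)]
  rw [coordTrace_add, ← coordTrace_swap fun v w => chartForm _ _ _ (secondForm _ _ _ _ _ _ _ w) _,
    ← two_mul]
  simp only [secondForm_symm hy (localRep_mem_target hq) hu x]

theorem sum_invCoeff_covDeriv_pullbackMetric (j : Fin n) :
    ∑ k, ∑ i, invCoeff g p y k i * covDeriv g (pullbackMetric h f) p k i j y =
      chartForm (metricTensor h) q (localRep p q f y) (tensionCoord g p h q (localRep p q f) y)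
          (fderiv ℝ (localRep p q f) y 𝐞[j]) +
        1 / 2 * fderiv ℝ
          (fun z => coordTrace g p z fun v w => chartForm (pullbackMetric h f) p z v w) y 𝐞[j] := by
  set H := chartForm (metricTensor h) q (localRep p q f y)
  set du : (𝔼 n) →L[ℝ] 𝔼 m := fderiv ℝ (localRep p q f) y
  set II := secondForm g p h q (localRep p q f) y
  have hdiv : ∑ k, ∑ i, invCoeff g p y k i * covDeriv g (pullbackMetric h f) p k i j y =
      coordTrace g p y (fun v w => H (II v w) (du 𝐞[j])) +
        coordTrace g p y fun v w => H (II v 𝐞[j]) (du w) := by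
    rw [← coordTrace_add]
    simp only [covDeriv_eq _ hy, covDeriv_pullbackMetric hy hf hq,
      chartForm_metric_symm h q _ (fderiv ℝ _ y _)]
    rfl
  have htension : coordTrace g p y (fun v w => H (II v w) (du 𝐞[j])) =
      H (tensionCoord g p h q (localRep p q f) y) (du 𝐞[j]) :=
    (map_coordTrace (H.flip (du 𝐞[j])).toLinearMap II).symm
  rw [hdiv, fderiv_coordTrace_pullbackMetric hy hf hq, htension]
  ring

end

end PullbackMetric

section DivergenceFormula

variable {n m : ℕ} {M : Type*} [TopologicalSpace M] [ChartedSpace (𝔼 n) M] [IsManifold (𝓡 n) ∞ M]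
  {N : Type*} [TopologicalSpace N] [ChartedSpace (𝔼 m) N] {p x : M} {q : N} {f : M → N} {y : 𝔼 n}

theorem tensor2_coordFrame (φ : Tensor2 m N) {z : N} (hz : z ∈ (extChartAt (𝓡 m) q).source)
    (v w : 𝔼 m) :
    φ z (show TangentSpace (𝓡 m) z from coordFrame q (extChartAt (𝓡 m) q z) v)
        (show TangentSpace (𝓡 m) z from coordFrame q (extChartAt (𝓡 m) q z) w) =
      chartForm φ q (extChartAt (𝓡 m) q z) v w :=
  tensor2_congr φ ((extChartAt (𝓡 m) q).left_inv hz).symm _ _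

theorem mvfderiv_eq_fderiv_chart {F : M → ℝ} (hx : x ∈ (extChartAt (𝓡 n) p).source)
    (hF : DifferentiableAt ℝ (fun z => F ((extChartAt (𝓡 n) p).symm z)) (extChartAt (𝓡 n) p x))
    (Y : TangentSpace (𝓡 n) x) :
    mvfderiv (𝓡 n) F x Y = fderiv ℝ (fun z => F ((extChartAt (𝓡 n) p).symm z))
      (extChartAt (𝓡 n) p x) (mfderiv (𝓡 n) 𝓘(ℝ, 𝔼 n) (extChartAt (𝓡 n) p) x Y) := by
  have hev : F =ᶠ[𝓝 x]
      (fun z => F ((extChartAt (𝓡 n) p).symm z)) ∘ extChartAt (𝓡 n) p := by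
    filter_upwards [(isOpen_extChartAt_source p).mem_nhds hx] with z hz
    exact congrArg F ((extChartAt (𝓡 n) p).left_inv hz).symm
  have hcomp := mfderiv_comp x hF.mdifferentiableAt
    ((contMDiffAt_chart hx).mdifferentiableAt (by simp))
  rw [mfderiv_eq_fderiv] at hcomp
  exact (congrArg (fun L : (𝔼 n) →L[ℝ] ℝ => L Y) hev.mfderiv_eq).trans
    (congrArg (fun L : (𝔼 n) →L[ℝ] ℝ => L Y) hcomp)

variable [IsManifold (𝓡 m) ∞ N]

theorem mfderiv_eq_coordFrame (hx : x ∈ (extChartAt (𝓡 n) p).source)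
    (hf : ContMDiffAt (𝓡 n) (𝓡 m) ∞ f x) (hq : f x ∈ (extChartAt (𝓡 m) q).source)
    (Y : TangentSpace (𝓡 n) x) :
    (mfderiv (𝓡 n) (𝓡 m) f x Y : 𝔼 m) = coordFrame q (extChartAt (𝓡 m) q (f x))
      (fderiv ℝ (localRep p q f) (extChartAt (𝓡 n) p x)
        (mfderiv (𝓡 n) 𝓘(ℝ, 𝔼 n) (extChartAt (𝓡 n) p) x Y)) := by
  obtain ⟨y, hy, rfl⟩ : ∃ y ∈ (extChartAt (𝓡 n) p).target, (extChartAt (𝓡 n) p).symm y = x :=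
    ⟨_, (extChartAt (𝓡 n) p).map_source hx, (extChartAt (𝓡 n) p).left_inv hx⟩
  have hright := (extChartAt (𝓡 n) p).right_inv hy
  have hY : (Y : 𝔼 n) = coordFrame p y
      (mfderiv (𝓡 n) 𝓘(ℝ, 𝔼 n) (extChartAt (𝓡 n) p) ((extChartAt (𝓡 n) p).symm y) Y) :=
    (coordFrame_mfderiv_chart hx Y).symm.trans
      (congrArg (fun z => (coordFrame p z _ : 𝔼 n)) hright)
  rw [hright]
  exact (congrArg (mfderiv (𝓡 n) (𝓡 m) f _) hY).trans (mfderiv_coordFrame hy hf hq _)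

theorem energyDensity_chart (g : Metric n M) (h : Metric m N) (f : M → N)
    (hy : y ∈ (extChartAt (𝓡 n) p).target) :
    energyDensity g h f ((extChartAt (𝓡 n) p).symm y) =
      coordTrace g p y fun v w => chartForm (pullbackMetric h f) p y v w := by
  rw [energyDensity, traceMetric_eq_coordTrace _ ((extChartAt (𝓡 n) p).map_target hy),
    (extChartAt (𝓡 n) p).right_inv hy]

theorem inner_tension_mfderiv (g : Metric n M) (h : Metric m N)
    (hf : ContMDiffAt (𝓡 n) (𝓡 m) ∞ f x) (Y : TangentSpace (𝓡 n) x) :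
    h.inner (f x) (tension g h f x) (mfderiv (𝓡 n) (𝓡 m) f x Y) =
      chartForm (metricTensor h) (f x) (localRep x (f x) f (extChartAt (𝓡 n) x x))
        (tensionCoord g x h (f x) (localRep x (f x) f) (extChartAt (𝓡 n) x x))
        (fderiv ℝ (localRep x (f x) f) (extChartAt (𝓡 n) x x)
          (mfderiv (𝓡 n) 𝓘(ℝ, 𝔼 n) (extChartAt (𝓡 n) x) x Y)) := by
  rw [localRep_center, ← tensor2_coordFrame _ (mem_extChartAt_source (f x))]
  exact congrArg₂ (fun a b => h.inner (f x) a b) (tension_eq_coordFrame hf)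
    (mfderiv_eq_coordFrame (mem_extChartAt_source x) hf (mem_extChartAt_source (f x)) Y)

theorem divergence_add_half_mvfderiv (g : Metric n M) (h : Metric m N)
    (hf : ContMDiff (𝓡 n) (𝓡 m) ∞ f) (x : M) (Y : TangentSpace (𝓡 n) x) :
    divergence g (pullbackMetric h f) x Y + 1 / 2 * mvfderiv (𝓡 n) (energyDensity g h f) x Y =
      -h.inner (f x) (tension g h f x) (mfderiv (𝓡 n) (𝓡 m) f x Y) := by
  have hx := mem_extChartAt_source (I := 𝓡 n) x
  have hy := mem_extChartAt_target (I := 𝓡 n) x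
  have hq : f ((extChartAt (𝓡 n) x).symm (extChartAt (𝓡 n) x x)) ∈
      (extChartAt (𝓡 m) (f x)).source := by
    rw [extChartAt_to_inv]
    exact mem_extChartAt_source (f x)
  have henergy : (fun z => energyDensity g h f ((extChartAt (𝓡 n) x).symm z))
      =ᶠ[𝓝 (extChartAt (𝓡 n) x x)]
      fun z => coordTrace g x z fun v w => chartForm (pullbackMetric h f) x z v w := by
    filter_upwards [(isOpen_extChartAt_target x).mem_nhds hy] with z hz
    exact energyDensity_chart g h f hz
  have hdiff : DifferentiableAt ℝ (fun z => coordTrace g x z fun v w =>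
      chartForm (pullbackMetric h f) x z v w) (extChartAt (𝓡 n) x x) :=
    differentiableAt_coordTrace hy (differentiableAt_chartForm_pullbackMetric hy hf hq)
  rw [mvfderiv_eq_fderiv_chart hx (hdiff.congr_of_eventuallyEq henergy), henergy.fderiv_eq,
    divergence, inner_tension_mfderiv g h hf.contMDiffAt]
  simp only [sum_invCoeff_covDeriv_pullbackMetric hy hf hq]
  set y := extChartAt (𝓡 n) x x
  set v : 𝔼 n := mfderiv (𝓡 n) 𝓘(ℝ, 𝔼 n) (extChartAt (𝓡 n) x) x Y
  have hsum (L : (𝔼 n) →L[ℝ] ℝ) : ∑ j, L 𝐞[j] * component x Y j = L v := sum_mul_component Y L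
  have hparts := hsum ((chartForm (metricTensor h) (f x) (localRep x (f x) f y)
    (tensionCoord g x h (f x) (localRep x (f x) f) y)).comp (fderiv ℝ (localRep x (f x) f) y) +
      (1 / 2 : ℝ) • fderiv ℝ (fun z => coordTrace g x z fun v w =>
        chartForm (pullbackMetric h f) x z v w) y)
  simp only [add_apply, smul_apply, smul_eq_mul, ContinuousLinearMap.comp_apply] at hparts
  rw [hparts]
  ring

end DivergenceFormula

section Transition

variable {n : ℕ} {M : Type*} [TopologicalSpace M] [ChartedSpace (𝔼 n) M] [IsManifold (𝓡 n) ∞ M]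
  {g : Metric n M} {p p' : M} {y : 𝔼 n}

theorem pullbackMetric_id (g : Metric n M) : pullbackMetric g (id : M → M) = metricTensor g := by
  ext x v w
  simp [pullbackMetric, metricTensor, mfderiv_id]

theorem surjective_fderiv_transition (g : Metric n M) (hy : y ∈ (extChartAt (𝓡 n) p).target)
    (hp' : (extChartAt (𝓡 n) p).symm y ∈ (extChartAt (𝓡 n) p').source) :
    Function.Surjective (fderiv ℝ (localRep p p' (id : M → M)) y : (𝔼 n) →L[ℝ] 𝔼 n) := by
  have hinj : Function.Injective
      ((fderiv ℝ (localRep p p' (id : M → M)) y : (𝔼 n) →L[ℝ] 𝔼 n) : (𝔼 n) →ₗ[ℝ] 𝔼 n) := by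
    refine (injective_iff_map_eq_zero _).2 fun v hv => ?_
    by_contra hne
    refine (chartForm_metric_pos g hy hne).ne' ?_
    rw [chartForm_transition _ hy hp']
    exact (congrArg (chartForm (metricTensor g) p' _ · _) hv).trans (by simp)
  exact LinearMap.injective_iff_surjective.1 hinj

-- The second fundamental form of an isometry is symmetric in its two arguments and, once paired
-- with the differential, skew in the last two slots; such a trilinear form vanishes.
theorem secondForm_transition (hy : y ∈ (extChartAt (𝓡 n) p).target)
    (hp' : (extChartAt (𝓡 n) p).symm y ∈ (extChartAt (𝓡 n) p').source) (v w : 𝔼 n) :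
    secondForm g p g p' (localRep p p' (id : M → M)) y v w = 0 := by
  have hq : localRep p p' (id : M → M) y ∈ (extChartAt (𝓡 n) p').target := localRep_mem_target hp'
  have hu : ContDiffAt ℝ 2 (localRep p p' (id : M → M)) y :=
    (contDiffAt_localRep hy contMDiffAt_id hp').of_le ENat.LEInfty.out
  have hskew (a b c : 𝔼 n) :=
    (covDeriv_pullbackMetric (g := g) (h := g) hy contMDiff_id hp' a b c).symm
  simp only [pullbackMetric_id, ← fderiv_bilin_apply (differentiableAt_chartForm_metric hy),
    fderiv_chartForm_metric hy, add_sub_cancel_left, sub_self] at hskew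
  refine chartForm_metric_ext g hq fun x => ?_
  obtain ⟨z, rfl⟩ := surjective_fderiv_transition g hy hp' x
  have hswap (a b c : 𝔼 n) := chartForm_metric_symm g p' (localRep p p' (id : M → M) y)
    (fderiv ℝ (localRep p p' (id : M → M)) y a) (secondForm g p g p' (localRep p p' id) y b c)
  have hvw := hskew v w z
  have hwz := hskew w z v
  have hzv := hskew z v w
  simp only [hswap] at hvw hwz hzv
  rw [secondForm_symm hy hq hu z v] at hzv
  rw [secondForm_symm hy hq hu w v] at hwz
  rw [secondForm_symm hy hq hu z w] at hzv
  rw [map_zero, zero_apply]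
  linarith

end Transition

/-- Fields of covectors on the tangent spaces of `M`. -/
abbrev OneForm (n : ℕ) (M : Type*) [TopologicalSpace M] [ChartedSpace (𝔼 n) M] :=
  (x : M) → TangentSpace (𝓡 n) x →L[ℝ] ℝ

section OneForms

variable {n : ℕ} {M : Type*} [TopologicalSpace M] [ChartedSpace (𝔼 n) M]
  {θ : OneForm n M} {p p' : M} {y : 𝔼 n}

/-- The expression of a 1-form in the chart at `p`. -/
def chartCovector (θ : OneForm n M) (p : M) (y : 𝔼 n) :
    (𝔼 n) →L[ℝ] ℝ :=
  (θ ((extChartAt (𝓡 n) p).symm y)).comp (coordFrame p y)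

/-- A 1-form is `C¹` if its expressions in all charts are. -/
def IsC1Form (θ : OneForm n M) : Prop :=
  ∀ (p : M), ∀ y ∈ (extChartAt (𝓡 n) p).target, ContDiffAt ℝ 1 (chartCovector θ p) y

theorem covector_congr (θ : OneForm n M) {x x' : M} (h : x = x')
    (v : 𝔼 n) : θ x (show TangentSpace (𝓡 n) x from v) =
      θ x' (show TangentSpace (𝓡 n) x' from v) := by
  subst h
  rfl

theorem IsC1Form.differentiableAt (hθ : IsC1Form θ) (hy : y ∈ (extChartAt (𝓡 n) p).target) :
    DifferentiableAt ℝ (chartCovector θ p) y :=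
  (hθ p y hy).differentiableAt one_ne_zero

variable [IsManifold (𝓡 n) ∞ M] {g : Metric n M}

theorem chartCovector_transition (hy : y ∈ (extChartAt (𝓡 n) p).target)
    (hp' : (extChartAt (𝓡 n) p).symm y ∈ (extChartAt (𝓡 n) p').source) (v : 𝔼 n) :
    chartCovector θ p y v = chartCovector θ p' (localRep p p' (id : M → M) y)
      (fderiv ℝ (localRep p p' (id : M → M)) y v) := by
  have hid := mfderiv_coordFrame hy contMDiffAt_id hp' v
  rw [mfderiv_id] at hid
  exact (covector_congr θ ((extChartAt (𝓡 n) p').left_inv hp').symm _).trans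
    (congrArg (fun a => θ ((extChartAt (𝓡 n) p').symm (localRep p p' (id : M → M) y)) a) hid)

/-- The covariant derivative `(∇_v α)(w)` of a covector field written in the chart at `p`. -/
def covDerivForm (g : Metric n M) (p : M) (α : (𝔼 n) → (𝔼 n) →L[ℝ] ℝ) (y : 𝔼 n) :
    (𝔼 n) →L[ℝ] (𝔼 n) →L[ℝ] ℝ :=
  fderiv ℝ α y - LinearMap.toContinuousBilinearMap
    ((christoffelForm g p y).compr₂ (α y).toLinearMap)

theorem covDerivForm_apply (α : (𝔼 n) → (𝔼 n) →L[ℝ] ℝ) (v w : 𝔼 n) :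
    covDerivForm g p α y v w = fderiv ℝ α y v w - α y (christoffelForm g p y v w) :=
  rfl

theorem covDerivForm_transition (hθ : IsC1Form θ) (hy : y ∈ (extChartAt (𝓡 n) p).target)
    (hp' : (extChartAt (𝓡 n) p).symm y ∈ (extChartAt (𝓡 n) p').source) (v w : 𝔼 n) :
    covDerivForm g p (chartCovector θ p) y v w =
      covDerivForm g p' (chartCovector θ p') (localRep p p' (id : M → M) y)
        (fderiv ℝ (localRep p p' (id : M → M)) y v)
        (fderiv ℝ (localRep p p' (id : M → M)) y w) := by
  have hq : localRep p p' (id : M → M) y ∈ (extChartAt (𝓡 n) p').target := localRep_mem_target hp'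
  have hu : ContDiffAt ℝ 2 (localRep p p' (id : M → M)) y :=
    (contDiffAt_localRep hy contMDiffAt_id hp').of_le ENat.LEInfty.out
  have hu1 : DifferentiableAt ℝ (localRep p p' (id : M → M)) y := hu.differentiableAt (by simp)
  have hcov : (chartCovector θ p · w) =ᶠ[𝓝 y] fun z =>
      chartCovector θ p' (localRep p p' (id : M → M) z)
        (fderiv ℝ (localRep p p' (id : M → M)) z w) := by
    filter_upwards [(isOpen_extChartAt_target p).mem_nhds hy,
      (contMDiffAt_chart_symm hy).continuousAt.preimage_mem_nhds
        ((isOpen_extChartAt_source p').mem_nhds hp')] with z hz hzp'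
    exact chartCovector_transition hz hzp' w
  have hderiv : fderiv ℝ (chartCovector θ p) y v w =
      fderiv ℝ (chartCovector θ p') (localRep p p' (id : M → M) y)
          (fderiv ℝ (localRep p p' (id : M → M)) y v)
          (fderiv ℝ (localRep p p' (id : M → M)) y w) +
        chartCovector θ p' (localRep p p' (id : M → M) y)
          (fderiv ℝ (fun z => fderiv ℝ (localRep p p' (id : M → M)) z w) y v) := by
    have hcomp := (hθ.differentiableAt hq).hasFDerivAt.comp y hu1.hasFDerivAt
    have happly := (hθ.differentiableAt hy).hasFDerivAt.clm_apply (hasFDerivAt_const w y)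
    have hprod := (hcomp.clm_apply (differentiableAt_fderiv_apply hu w).hasFDerivAt)
    have := DFunLike.congr_fun (happly.unique (hprod.congr_of_eventuallyEq hcov)) v
    simpa [add_comm] using this
  have hII := secondForm_transition (g := g) hy hp' v w
  rw [secondForm, covDerivAlong, sub_eq_zero] at hII
  rw [covDerivForm_apply, covDerivForm_apply, hderiv, chartCovector_transition hy hp', ← hII,
    map_add]
  ring

/-- The divergence `trace_g (∇θ)` of a 1-form, computed at `x` in the chart at `x`. -/
def divForm (g : Metric n M) (θ : OneForm n M) (x : M) : ℝ :=
  coordTrace g x (extChartAt (𝓡 n) x x) fun v w =>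
    covDerivForm g x (chartCovector θ x) (extChartAt (𝓡 n) x x) v w

theorem divForm_chart (hθ : IsC1Form θ) (hy : y ∈ (extChartAt (𝓡 n) p).target) :
    divForm g θ ((extChartAt (𝓡 n) p).symm y) =
      coordTrace g p y fun v w => covDerivForm g p (chartCovector θ p) y v w := by
  have hx := mem_extChartAt_source (I := 𝓡 n) ((extChartAt (𝓡 n) p).symm y)
  simp only [covDerivForm_transition hθ hy hx]
  exact (coordTrace_transition hy hx _).symm

end OneForms

section CoordinateDivergence

variable {n : ℕ} {M : Type*} [TopologicalSpace M] [ChartedSpace (𝔼 n) M] [IsManifold (𝓡 n) ∞ M]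
  {g : Metric n M} {p : M} {y : 𝔼 n} {α : (𝔼 n) → (𝔼 n) →L[ℝ] ℝ}

theorem raise_chartForm (hy : y ∈ (extChartAt (𝓡 n) p).target) (v : 𝔼 n) :
    raise g p y (chartForm (metricTensor g) p y v) = v :=
  chartForm_metric_ext g hy fun x => by rw [chartForm_raise hy]

theorem coordTrace_chartForm (hy : y ∈ (extChartAt (𝓡 n) p).target) (A : (𝔼 n) → 𝔼 n) :
    coordTrace g p y (fun v w => chartForm (metricTensor g) p y (A v) w) = ∑ i, A 𝐞[i] i :=
  Finset.sum_congr rfl fun i _ => by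
    conv_rhs => rw [← raise_chartForm (g := g) hy (A 𝐞[i]), raise_apply]
    rfl

theorem contDiffAt_raise {k : ℕ} (hy : y ∈ (extChartAt (𝓡 n) p).target)
    (hα : ContDiffAt ℝ k α y) : ContDiffAt ℝ k (fun z => raise g p z (α z)) y := by
  refine contDiffAt_euclidean.2 fun i => ?_
  simp only [raise_apply]
  exact ContDiffAt.sum fun l _ =>
    ((contDiffAt_invCoeff hy i l).of_le (mod_cast le_top)).mul (hα.clm_apply contDiffAt_const)

theorem covDerivForm_eq_chartForm (hy : y ∈ (extChartAt (𝓡 n) p).target)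
    (hα : ContDiffAt ℝ 1 α y) (v w : 𝔼 n) :
    covDerivForm g p α y v w = chartForm (metricTensor g) p y
      (covDerivAlong g p (fun z => z) (fun z => raise g p z (α z)) y v) w := by
  have hlower : (fun z => α z w) =ᶠ[𝓝 y]
      fun z => chartForm (metricTensor g) p z (raise g p z (α z)) w := by
    filter_upwards [(isOpen_extChartAt_target p).mem_nhds hy] with z hz
    rw [chartForm_raise hz]
  have hα1 := hα.differentiableAt one_ne_zero
  have hX : DifferentiableAt ℝ (fun z => raise g p z (α z)) y :=
    (contDiffAt_raise (k := 1) hy hα).differentiableAt one_ne_zero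
  have hαw : fderiv ℝ α y v w = fderiv ℝ (fun z => α z w) y v := by
    simp [fderiv_clm_apply hα1 (differentiableAt_const w)]
  rw [covDerivForm_apply, hαw, hlower.fderiv_eq,
    fderiv_metric_along (u := fun z => z) hy differentiableAt_fun_id hX (differentiableAt_const w)]
  conv_lhs => rw [chartForm_raise hy]
  simp [covDerivAlong]

/-- The density `√(det gᵢⱼ)` of the Riemannian volume in the chart at `p`. -/
def volDensity (g : Metric n M) (p : M) (y : 𝔼 n) : ℝ :=
  √(coeff (metricTensor g) p y).det

theorem volDensity_pos (hy : y ∈ (extChartAt (𝓡 n) p).target) : 0 < volDensity g p y :=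
  Real.sqrt_pos.2 (coeff_metric_det_pos hy)

theorem contDiffAt_volDensity (hy : y ∈ (extChartAt (𝓡 n) p).target) :
    ContDiffAt ℝ ∞ (volDensity g p) y :=
  (contDiffAt_det (contDiffAt_coeff_metric hy)).sqrt (coeff_metric_det_pos hy).ne'

theorem continuousOn_volDensity (g : Metric n M) (p : M) :
    ContinuousOn (volDensity g p) (extChartAt (𝓡 n) p).target :=
  fun _ hy => (contDiffAt_volDensity hy).continuousAt.continuousWithinAt

theorem fderiv_volDensity (hy : y ∈ (extChartAt (𝓡 n) p).target) (v : 𝔼 n) :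
    fderiv ℝ (volDensity g p) y v = volDensity g p y * (connectionMatrix g p y v).trace := by
  have hdet := coeff_metric_det_pos (g := g) hy
  have hcoeff (i j : Fin n) : DifferentiableAt ℝ (fun z => coeff (metricTensor g) p z i j) y :=
    (contDiffAt_coeff_metric hy i j).differentiableAt (by simp)
  have hdiff : DifferentiableAt ℝ (fun z => (coeff (metricTensor g) p z).det) y :=
    (contDiffAt_det fun i j => contDiffAt_coeff_metric hy i j).differentiableAt
      (n := ∞) (by simp)
  unfold volDensity
  rw [fderiv_sqrt hdiff hdet.ne', smul_apply, fderiv_det_apply hcoeff hdet.ne',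
    entryDeriv_coeff_metric hy, Matrix.mul_add, Matrix.trace_add,
    Matrix.nonsing_inv_mul_cancel_left _ _ hdet.ne'.isUnit, Matrix.trace_mul_comm,
    Matrix.mul_assoc, Matrix.mul_nonsing_inv _ hdet.ne'.isUnit, Matrix.mul_one,
    Matrix.trace_transpose, smul_eq_mul]
  field_simp [(Real.sqrt_pos.2 hdet).ne']
  rw [Real.sq_sqrt hdet.le]
  ring

theorem volDensity_mul_coordTrace_covDerivForm (hy : y ∈ (extChartAt (𝓡 n) p).target)
    (hα : ContDiffAt ℝ 1 α y) :
    volDensity g p y * coordTrace g p y (fun v w => covDerivForm g p α y v w) =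
      ∑ j, pd j (fun z => volDensity g p z * raise g p z (α z) j) y := by
  have hX : DifferentiableAt ℝ (fun z => raise g p z (α z)) y :=
    (contDiffAt_raise (k := 1) hy hα).differentiableAt one_ne_zero
  have hXj (j : Fin n) : DifferentiableAt ℝ (fun z => raise g p z (α z) j) y :=
    differentiableAt_euclidean.1 hX j
  have hdens : DifferentiableAt ℝ (volDensity g p) y :=
    (contDiffAt_volDensity hy).differentiableAt (by simp)
  have hdensity : ∑ j, raise g p y (α y) j *
      fderiv ℝ (volDensity g p) y 𝐞[j] =
      volDensity g p y *
        ∑ j, christoffelForm g p y 𝐞[j] (raise g p y (α y)) j := by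
    simp only [christoffelForm_symm hy 𝐞[_]]
    rw [show ∑ j, christoffelForm g p y (raise g p y (α y)) 𝐞[j] j =
      (connectionMatrix g p y (raise g p y (α y))).trace from rfl, ← fderiv_volDensity hy]
    conv_rhs => rw [← sum_smul_single (raise g p y (α y))]
    simp only [map_sum, map_smul, smul_eq_mul]
  simp only [covDerivForm_eq_chartForm hy hα, coordTrace_chartForm hy, pd,
    fderiv_fun_mul hdens (hXj _), add_apply, smul_apply, smul_eq_mul, Finset.sum_add_distrib,
    hdensity, covDerivAlong, PiLp.add_apply, fderiv_fun_id, ContinuousLinearMap.id_apply,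
    fderiv_coord hX, mul_add, Finset.mul_sum]

end CoordinateDivergence

section Jacobian

variable {n : ℕ} {M : Type*} [TopologicalSpace M] [ChartedSpace (𝔼 n) M]

theorem det_fderiv_transition (p q : M) (y : 𝔼 n) :
    (fderiv ℝ (localRep p q (id : M → M)) y : (𝔼 n) →L[ℝ] 𝔼 n).det =
      (transitionJacobian p q y).det := by
  rw [ContinuousLinearMap.det, ← LinearMap.det_toMatrix (EuclideanSpace.basisFun (Fin n) ℝ).toBasis]
  congr 1

variable [IsManifold (𝓡 n) ∞ M] {g : Metric n M} {p q : M}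

theorem volDensity_transition {y : 𝔼 n} (hy : y ∈ (extChartAt (𝓡 n) p).target)
    (hq : (extChartAt (𝓡 n) p).symm y ∈ (extChartAt (𝓡 n) q).source) :
    volDensity g p y = |(fderiv ℝ (localRep p q (id : M → M)) y : (𝔼 n) →L[ℝ] 𝔼 n).det| *
      volDensity g q (localRep p q (id : M → M) y) := by
  rw [det_fderiv_transition, volDensity, volDensity, coeff_transition _ hy hq, Matrix.det_mul,
    Matrix.det_mul, Matrix.det_transpose, ← Real.sqrt_sq_eq_abs, ← Real.sqrt_mul (sq_nonneg _)]
  ring_nf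

end Jacobian

section Volume

variable {n : ℕ} {M : Type*} [TopologicalSpace M] [ChartedSpace (𝔼 n) M]
  [MeasurableSpace M] [BorelSpace M]

theorem measurableSet_chart_source (p : M) : MeasurableSet (extChartAt (𝓡 n) p).source :=
  (isOpen_extChartAt_source p).measurableSet

theorem measurableSet_chart_preimage (p : M) {s : Set M} (hs : MeasurableSet s) :
    MeasurableSet ((extChartAt (𝓡 n) p).target ∩ (extChartAt (𝓡 n) p).symm ⁻¹' s) := by
  have hcont := continuousOn_iff_continuous_domRestrict.1
    (continuousOn_extChartAt_symm (I := 𝓡 n) p)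
  have himage := (isOpen_extChartAt_target (I := 𝓡 n) p).measurableSet.subtype_image
    (hcont.measurable hs)
  rwa [domRestrict_eq, preimage_comp, Subtype.image_preimage_coe] at himage

variable [IsManifold (𝓡 n) ∞ M] {g : Metric n M} {p q : M}

theorem aemeasurable_chart_symm (g : Metric n M) (p : M) :
    AEMeasurable (extChartAt (𝓡 n) p).symm
      ((volume.restrict (extChartAt (𝓡 n) p).target).withDensity
        fun y => ENNReal.ofReal (volDensity g p y)) :=
  ((continuousOn_extChartAt_symm p).aemeasurable
    (isOpen_extChartAt_target p).measurableSet).mono_ac (withDensity_absolutelyContinuous _ _)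

theorem chartVolume_apply (g : Metric n M) (p : M) {s : Set M} (hs : MeasurableSet s) :
    chartVolume g p s = ∫⁻ y in (extChartAt (𝓡 n) p).target ∩ (extChartAt (𝓡 n) p).symm ⁻¹' s,
      ENNReal.ofReal (volDensity g p y) := by
  refine (Measure.map_apply_of_aemeasurable (aemeasurable_chart_symm g p) hs).trans ?_
  rw [withDensity_apply', Measure.restrict_restrict₀', inter_comm]
  exact (isOpen_extChartAt_target p).measurableSet.nullMeasurableSet

theorem chartVolume_eq_of_subset {s : Set M} (hs : MeasurableSet s)
    (hp : s ⊆ (extChartAt (𝓡 n) p).source) (hq : s ⊆ (extChartAt (𝓡 n) q).source) :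
    chartVolume g p s = chartVolume g q s := by
  have hA := measurableSet_chart_preimage (n := n) p hs
  rw [chartVolume_apply g p hs, chartVolume_apply g q hs]
  have himage : (extChartAt (𝓡 n) q).target ∩ (extChartAt (𝓡 n) q).symm ⁻¹' s =
      localRep p q id '' ((extChartAt (𝓡 n) p).target ∩ (extChartAt (𝓡 n) p).symm ⁻¹' s) := by
    rw [← PartialEquiv.image_eq_target_inter_inv_preimage _ hp,
      ← PartialEquiv.image_eq_target_inter_inv_preimage _ hq]
    refine Eq.trans ?_ (image_comp _ (extChartAt (𝓡 n) p).symm _).symm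
    rw [PartialEquiv.symm_image_image_of_subset_source _ hp]
  have hinj : InjOn (localRep p q id)
      ((extChartAt (𝓡 n) p).target ∩ (extChartAt (𝓡 n) p).symm ⁻¹' s) := fun y hy z hz hyz =>
    (extChartAt (𝓡 n) p).symm.injOn hy.1 hz.1
      ((extChartAt (𝓡 n) q).injOn (hq hy.2) (hq hz.2) hyz)
  rw [himage, lintegral_image_eq_lintegral_abs_det_fderiv_mul volume hA
    (fun y hy => ((contDiffAt_localRep hy.1 contMDiffAt_id (hq hy.2)).differentiableAt
      (by simp)).hasFDerivAt.hasFDerivWithinAt) hinj]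
  refine setLIntegral_congr_fun hA fun y hy => ?_
  rw [← ENNReal.ofReal_mul (abs_nonneg _), volDensity_transition hy.1 (hq hy.2)]

theorem chartVolume_inter_source (g : Metric n M) (p : M) {s : Set M} (hs : MeasurableSet s) :
    chartVolume g p (s ∩ (extChartAt (𝓡 n) p).source) = chartVolume g p s := by
  rw [chartVolume_apply g p hs, chartVolume_apply g p (hs.inter (measurableSet_chart_source p))]
  congr 2
  ext y
  exact ⟨fun h => ⟨h.1, h.2.1⟩, fun h => ⟨h.1, h.2, (extChartAt (𝓡 n) p).map_target h.1⟩⟩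

-- The measure that agrees with the chart volume on the chart domain and is infinite outside
-- dominates the volumes of all the charts.
theorem riemannianVolume_apply {s : Set M} (hs : MeasurableSet s)
    (hp : s ⊆ (extChartAt (𝓡 n) p).source) : riemannianVolume g s = chartVolume g p s := by
  refine le_antisymm ?_ (le_iSup (fun p => chartVolume g p) p s)
  have hle : riemannianVolume g ≤
      chartVolume g p + (⊤ : Measure M).restrict (extChartAt (𝓡 n) p).sourceᶜ := by
    refine iSup_le fun q => Measure.le_iff.2 fun t ht => ?_
    have hpt := ht.inter (measurableSet_chart_source (n := n) p)
    rw [← measure_inter_add_sdiff t (measurableSet_chart_source (n := n) p), Measure.add_apply]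
    refine add_le_add ?_ ?_
    · rw [← chartVolume_inter_source g q hpt, chartVolume_eq_of_subset (q := p)
        (hpt.inter (measurableSet_chart_source q)) inter_subset_right
        (inter_subset_left.trans inter_subset_right)]
      exact measure_mono (inter_subset_left.trans inter_subset_left)
    · rw [Measure.restrict_apply ht, ← sdiff_eq]
      exact le_top (a := chartVolume g q) _
  refine (hle s).trans_eq ?_
  rw [Measure.add_apply, Measure.restrict_apply hs, ← sdiff_eq, sdiff_eq_empty.2 hp,
    measure_empty, add_zero]

theorem riemannianVolume_restrict_source (g : Metric n M) (p : M) :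
    (riemannianVolume g).restrict (extChartAt (𝓡 n) p).source = chartVolume g p := by
  ext s hs
  rw [Measure.restrict_apply hs,
    riemannianVolume_apply (hs.inter (measurableSet_chart_source p)) inter_subset_right,
    chartVolume_inter_source g p hs]

theorem integral_riemannianVolume_eq (g : Metric n M) (p : M) {w : M → ℝ}
    (hw : ContinuousOn w (extChartAt (𝓡 n) p).source)
    (h0 : ∀ x ∉ (extChartAt (𝓡 n) p).source, w x = 0) :
    ∫ x, w x ∂(riemannianVolume g) =
      ∫ y in (extChartAt (𝓡 n) p).target, volDensity g p y * w ((extChartAt (𝓡 n) p).symm y) := by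
  have htarget := (isOpen_extChartAt_target (I := 𝓡 n) p).measurableSet
  have hmeas := hw.aestronglyMeasurable (μ := riemannianVolume g) (measurableSet_chart_source p)
  rw [← setIntegral_eq_integral_of_forall_compl_eq_zero h0, riemannianVolume_restrict_source]
  rw [riemannianVolume_restrict_source] at hmeas
  refine (integral_map (aemeasurable_chart_symm g p) hmeas).trans ?_
  rw [integral_withDensity_eq_integral_toReal_smul₀
    ((continuousOn_volDensity g p).aemeasurable htarget).ennreal_ofReal (by simp)]
  refine setIntegral_congr_fun htarget fun y hy => ?_
  rw [ENNReal.toReal_ofReal (volDensity_pos hy).le, smul_eq_mul]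

instance isLocallyFiniteMeasure_riemannianVolume (g : Metric n M) :
    IsLocallyFiniteMeasure (riemannianVolume g) := by
  refine ⟨fun x => ?_⟩
  obtain ⟨C, hCx, hCtarget, hC⟩ := LocallyCompactSpace.local_compact_nhds _ _
    ((isOpen_extChartAt_target (I := 𝓡 n) x).mem_nhds (mem_extChartAt_target (I := 𝓡 n) x))
  set U := (extChartAt (𝓡 n) x).source ∩ extChartAt (𝓡 n) x ⁻¹' interior C
  have hU : IsOpen U :=
    (continuousOn_extChartAt x).isOpen_inter_preimage (isOpen_extChartAt_source x) isOpen_interior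
  refine ⟨U, hU.mem_nhds ⟨mem_extChartAt_source x, mem_interior_iff_mem_nhds.2 hCx⟩, ?_⟩
  rw [riemannianVolume_apply hU.measurableSet inter_subset_left,
    chartVolume_apply g x hU.measurableSet]
  obtain ⟨B, hB⟩ := hC.exists_bound_of_continuousOn ((continuousOn_volDensity g x).mono hCtarget)
  have hsub : (extChartAt (𝓡 n) x).target ∩ (extChartAt (𝓡 n) x).symm ⁻¹' U ⊆ C := by
    rintro y ⟨hy, -, hyC⟩
    rw [mem_preimage, (extChartAt (𝓡 n) x).right_inv hy] at hyC
    exact interior_subset hyC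
  calc ∫⁻ y in (extChartAt (𝓡 n) x).target ∩ (extChartAt (𝓡 n) x).symm ⁻¹' U,
        ENNReal.ofReal (volDensity g x y)
    _ ≤ ∫⁻ y in C, ENNReal.ofReal (volDensity g x y) := lintegral_mono_set hsub
    _ ≤ ∫⁻ _ in C, ENNReal.ofReal B := setLIntegral_mono' hC.measurableSet fun y hy =>
        ENNReal.ofReal_le_ofReal ((le_abs_self _).trans (hB y hy))
    _ < ⊤ := by
        rw [setLIntegral_const]
        exact ENNReal.mul_lt_top ENNReal.ofReal_lt_top hC.measure_lt_top

instance isOpenPosMeasure_riemannianVolume (g : Metric n M) :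
    (riemannianVolume g).IsOpenPosMeasure := by
  refine ⟨fun U hU ⟨x, hx⟩ hnull => ?_⟩
  have hV : IsOpen (U ∩ (extChartAt (𝓡 n) x).source) := hU.inter (isOpen_extChartAt_source x)
  have hzero := measure_mono_null (inter_subset_left (t := (extChartAt (𝓡 n) x).source)) hnull
  rw [riemannianVolume_apply hV.measurableSet inter_subset_right,
    chartVolume_apply g x hV.measurableSet] at hzero
  set W := (extChartAt (𝓡 n) x).target ∩
    (extChartAt (𝓡 n) x).symm ⁻¹' (U ∩ (extChartAt (𝓡 n) x).source)
  have hW : IsOpen W := (continuousOn_extChartAt_symm x).isOpen_inter_preimage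
    (isOpen_extChartAt_target x) hV
  have hWne : W.Nonempty := ⟨extChartAt (𝓡 n) x x, mem_extChartAt_target x, by
    rw [mem_preimage, extChartAt_to_inv]
    exact ⟨hx, mem_extChartAt_source x⟩⟩
  rw [setLIntegral_eq_zero_iff' hW.measurableSet
    ((continuousOn_volDensity g x).mono inter_subset_left |>.aemeasurable
      hW.measurableSet).ennreal_ofReal, ae_iff] at hzero
  refine (hW.measure_pos volume hWne).ne' (measure_mono_null ?_ hzero)
  exact fun y hy hzy => (volDensity_pos (g := g) hy.1).not_ge (ENNReal.ofReal_eq_zero.1 (hzy hy))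

end Volume

section EuclideanIntegral

variable {n : ℕ}

theorem continuous_pd {X : (𝔼 n) → ℝ} (hX : ContDiff ℝ 1 X) (j : Fin n) : Continuous (pd j X) :=
  (hX.continuous_fderiv one_ne_zero).clm_apply continuous_const

theorem hasCompactSupport_pd {X : (𝔼 n) → ℝ} (hX : HasCompactSupport X) (j : Fin n) :
    HasCompactSupport (pd j X) :=
  (hX.fderiv ℝ).comp_left (g := fun L : (𝔼 n) →L[ℝ] ℝ => L 𝐞[j]) (zero_apply _)

theorem integral_pd_eq_zero {X : (𝔼 n) → ℝ} (hX : ContDiff ℝ 1 X) (hc : HasCompactSupport X)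
    (j : Fin n) : ∫ y, pd j X y = 0 := by
  have hpd : Integrable (fun y => (1 : ℝ) * fderiv ℝ X y 𝐞[j]) := by
    simp only [one_mul]
    exact (continuous_pd hX j).integrable_of_hasCompactSupport (hasCompactSupport_pd hc j)
  have hparts := integral_mul_fderiv_eq_neg_fderiv_mul_of_integrable (μ := volume)
    (f := fun _ : 𝔼 n => (1 : ℝ)) (g := X) (v := 𝐞[j]) (by simp) hpd
    (by simpa using hX.continuous.integrable_of_hasCompactSupport hc)
    (fun x _ => differentiableAt_const _) (fun x _ => hX.differentiable one_ne_zero x)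
  simpa [pd] using hparts

theorem setIntegral_sum_pd_eq_zero {s K : Set (𝔼 n)} (hs : IsOpen s) (hK : IsCompact K)
    (hKs : K ⊆ s) {X : Fin n → (𝔼 n) → ℝ} (hX : ∀ j, ContDiffOn ℝ 1 (X j) s)
    (h0 : ∀ j, ∀ y ∈ s \ K, X j y = 0) : ∫ y in s, ∑ j, pd j (X j) y = 0 := by
  have heq (j : Fin n) {y : 𝔼 n} (hy : y ∈ s) : K.indicator (X j) =ᶠ[𝓝 y] X j := by
    filter_upwards [hs.mem_nhds hy] with z hz
    by_cases hzK : z ∈ K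
    · exact indicator_of_mem hzK _
    · rw [indicator_of_notMem hzK, h0 j z ⟨hz, hzK⟩]
  have hzero (j : Fin n) {y : 𝔼 n} (hy : y ∉ K) : K.indicator (X j) =ᶠ[𝓝 y] 0 := by
    filter_upwards [hK.isClosed.isOpen_compl.mem_nhds hy] with z hz
    exact indicator_of_notMem hz _
  have hsmooth (j : Fin n) : ContDiff ℝ 1 (K.indicator (X j)) := by
    refine contDiff_iff_contDiffAt.2 fun y => ?_
    by_cases hy : y ∈ s
    · exact ((hX j).contDiffAt (hs.mem_nhds hy)).congr_of_eventuallyEq (heq j hy)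
    · exact contDiffAt_const.congr_of_eventuallyEq (hzero j fun h => hy (hKs h))
  have hsupp (j : Fin n) : HasCompactSupport (K.indicator (X j)) :=
    HasCompactSupport.intro hK fun y hy => indicator_of_notMem hy _
  calc ∫ y in s, ∑ j, pd j (X j) y = ∫ y in s, ∑ j, pd j (K.indicator (X j)) y :=
        setIntegral_congr_fun hs.measurableSet fun y hy =>
          Finset.sum_congr rfl fun j _ => by rw [pd, pd, (heq j hy).fderiv_eq]
    _ = ∫ y, ∑ j, pd j (K.indicator (X j)) y :=
        setIntegral_eq_integral_of_forall_compl_eq_zero fun y hy =>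
          Finset.sum_eq_zero fun j _ => by
            rw [pd, (hzero j fun h => hy (hKs h)).fderiv_eq]
            simp
    _ = ∑ j, ∫ y, pd j (K.indicator (X j)) y := integral_finsetSum _ fun j _ =>
        (continuous_pd (hsmooth j) j).integrable_of_hasCompactSupport
          (hasCompactSupport_pd (hsupp j) j)
    _ = 0 := Finset.sum_eq_zero fun j _ => integral_pd_eq_zero (hsmooth j) (hsupp j) j

end EuclideanIntegral

section DivergenceTheorem

variable {n : ℕ} {M : Type*} [TopologicalSpace M] [ChartedSpace (𝔼 n) M]
  {θ η : OneForm n M} {ρ : M → ℝ} {p : M}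

theorem chartCovector_eq_zero {y : 𝔼 n} (hθ : θ ((extChartAt (𝓡 n) p).symm y) = 0) :
    chartCovector θ p y = 0 := by
  rw [chartCovector, hθ, ContinuousLinearMap.zero_comp]

variable [IsManifold (𝓡 n) ∞ M] {g : Metric n M}

theorem divForm_congr {x : M} (h : ∀ᶠ z in 𝓝 x, θ z = η z) : divForm g θ x = divForm g η x := by
  have hchart : chartCovector θ x =ᶠ[𝓝 (extChartAt (𝓡 n) x x)] chartCovector η x := by
    filter_upwards [(continuousAt_extChartAt_symm x).eventually
      ((extChartAt_to_inv (I := 𝓡 n) x).symm ▸ h :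
        ∀ᶠ z in 𝓝 ((extChartAt (𝓡 n) x).symm (extChartAt (𝓡 n) x x)), θ z = η z)] with z hz
    rw [chartCovector, chartCovector, hz]
  rw [divForm, divForm, covDerivForm, covDerivForm, hchart.fderiv_eq, hchart.eq_of_nhds]

theorem divForm_zero (g : Metric n M) (x : M) : divForm g (0 : OneForm n M) x = 0 := by
  have hzero : chartCovector (0 : OneForm n M) x = 0 := funext fun y => chartCovector_eq_zero rfl
  simp [divForm, covDerivForm_apply, hzero, coordTrace]

theorem divForm_eq_zero {K : Set M} (hK : IsClosed K) (h0 : ∀ x ∉ K, θ x = 0) {x : M} (hx : x ∉ K) :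
    divForm g θ x = 0 := by
  rw [divForm_congr (η := 0) (by filter_upwards [hK.isOpen_compl.mem_nhds hx] using h0),
    divForm_zero]

theorem divForm_add (hθ : IsC1Form θ) (hη : IsC1Form η) (x : M) :
    divForm g (θ + η) x = divForm g θ x + divForm g η x := by
  have hadd : chartCovector (θ + η) x = fun y => chartCovector θ x y + chartCovector η x y :=
    funext fun y => ContinuousLinearMap.add_comp _ _ _
  have hx := mem_extChartAt_target (I := 𝓡 n) x
  rw [divForm, divForm, divForm, ← coordTrace_add]
  congr! 3 with v w
  rw [covDerivForm_apply, covDerivForm_apply, covDerivForm_apply, hadd,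
    fderiv_fun_add (hθ.differentiableAt hx) (hη.differentiableAt hx)]
  simp only [add_apply]
  ring

theorem IsC1Form.smul (hθ : IsC1Form θ) (hρ : ContMDiff (𝓡 n) 𝓘(ℝ, ℝ) ∞ ρ) :
    IsC1Form fun x => ρ x • θ x := fun p y hy => by
  have hρy : ContDiffAt ℝ 1 (fun z => ρ ((extChartAt (𝓡 n) p).symm z)) y :=
    contMDiffAt_iff_contDiffAt.1 ((hρ.contMDiffAt.comp y (contMDiffAt_chart_symm hy)).of_le
      ENat.LEInfty.out)
  exact hρy.smul (hθ p y hy)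

theorem continuousOn_coordTrace_covDerivForm {α : (𝔼 n) → (𝔼 n) →L[ℝ] ℝ}
    (hα : ContDiffOn ℝ 1 α (extChartAt (𝓡 n) p).target) :
    ContinuousOn (fun y => coordTrace g p y fun v w => covDerivForm g p α y v w)
      (extChartAt (𝓡 n) p).target := by
  have hopen := isOpen_extChartAt_target (I := 𝓡 n) p
  have hα' {y} (hy : y ∈ (extChartAt (𝓡 n) p).target) := hα.contDiffAt (hopen.mem_nhds hy)
  have hX (j : Fin n) : ContinuousOn
      (pd j fun z => volDensity g p z * raise g p z (α z) j) (extChartAt (𝓡 n) p).target := by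
    have hX1 : ContDiffOn ℝ 1 (fun z => volDensity g p z * raise g p z (α z) j)
        (extChartAt (𝓡 n) p).target := fun y hy =>
      (((contDiffAt_volDensity hy).of_le ENat.LEInfty.out).mul (contDiffAt_euclidean.1
        (contDiffAt_raise (k := 1) hy (hα' hy)) j)).contDiffWithinAt
    exact (hX1.continuousOn_fderiv_of_isOpen hopen le_rfl).clm_apply continuousOn_const
  refine ((continuousOn_finsetSum Finset.univ fun j _ => hX j).div (continuousOn_volDensity g p)
    fun y hy => (volDensity_pos hy).ne').congr fun y hy => ?_
  refine (eq_div_iff (volDensity_pos hy).ne').2 ((mul_comm _ _).trans ?_)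
  exact volDensity_mul_coordTrace_covDerivForm hy (hα' hy)

theorem continuous_divForm (g : Metric n M) (hθ : IsC1Form θ) : Continuous (divForm g θ) := by
  refine continuous_iff_continuousAt.2 fun x => ?_
  have hchart := (continuousOn_coordTrace_covDerivForm (g := g) (p := x)
    fun y hy => (hθ x y hy).contDiffWithinAt).continuousAt
      ((isOpen_extChartAt_target x).mem_nhds (mem_extChartAt_target x))
  refine (hchart.comp (continuousAt_extChartAt x)).congr ?_
  filter_upwards [extChartAt_source_mem_nhds (I := 𝓡 n) x] with z hz
  have := divForm_chart (g := g) hθ ((extChartAt (𝓡 n) x).map_source hz)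
  rwa [(extChartAt (𝓡 n) x).left_inv hz, eq_comm] at this

variable [MeasurableSpace M] [BorelSpace M] [T2Space M]

theorem integrable_divForm (g : Metric n M) (hθ : IsC1Form θ) {K : Set M} (hK : IsCompact K)
    (h0 : ∀ x ∉ K, θ x = 0) : Integrable (divForm g θ) (riemannianVolume g) :=
  (continuous_divForm g hθ).integrable_of_hasCompactSupport
    (HasCompactSupport.intro hK fun _ => divForm_eq_zero hK.isClosed h0)

theorem integral_divForm_of_subset_source (g : Metric n M) (hθ : IsC1Form θ) {K : Set M}
    (hK : IsCompact K) (hKp : K ⊆ (extChartAt (𝓡 n) p).source) (h0 : ∀ x ∉ K, θ x = 0) :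
    ∫ x, divForm g θ x ∂(riemannianVolume g) = 0 := by
  have htarget := isOpen_extChartAt_target (I := 𝓡 n) p
  rw [integral_riemannianVolume_eq g p (continuous_divForm g hθ).continuousOn
    fun x hx => divForm_eq_zero hK.isClosed h0 fun h => hx (hKp h)]
  rw [setIntegral_congr_fun htarget.measurableSet fun y hy => by
    rw [divForm_chart hθ hy, volDensity_mul_coordTrace_covDerivForm hy (hθ p y hy)]]
  refine setIntegral_sum_pd_eq_zero htarget
    (hK.image_of_continuousOn ((continuousOn_extChartAt p).mono hKp))
    (image_subset_iff.2 fun x hx => (extChartAt (𝓡 n) p).map_source (hKp hx))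
    (fun j y hy => (((contDiffAt_volDensity hy).of_le ENat.LEInfty.out).mul
      (contDiffAt_euclidean.1 (contDiffAt_raise (k := 1) hy (hθ p y hy)) j)).contDiffWithinAt)
    fun j y hy => ?_
  have hθy : chartCovector θ p y = 0 :=
    chartCovector_eq_zero (h0 _ fun h => hy.2 ⟨_, h, (extChartAt (𝓡 n) p).right_inv hy.1⟩)
  rw [hθy, map_zero, PiLp.zero_apply, mul_zero]

theorem integral_divForm_one_sub_smul (g : Metric n M) (f : SmoothBumpFunction (𝓡 n) p)
    (hθ : IsC1Form θ) {K : Set M} (hK : IsCompact K) (h0 : ∀ x ∉ K, θ x = 0) :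
    ∫ x, divForm g (fun x => (1 - f x) • θ x) x ∂(riemannianVolume g) =
      ∫ x, divForm g θ x ∂(riemannianVolume g) := by
  have hfθ := hθ.smul f.contMDiff
  have hfθ' : IsC1Form fun x => (1 - f x) • θ x := hθ.smul (contMDiff_const.sub f.contMDiff)
  have hsplit : θ = (fun x => f x • θ x) + fun x => (1 - f x) • θ x := funext fun x => by
    rw [Pi.add_apply, ← add_smul, add_sub_cancel, one_smul]
  have hzero := integral_divForm_of_subset_source g hfθ f.hasCompactSupport.isCompact
    f.tsupport_subset_extChartAt_source fun x hx => by
      rw [image_eq_zero_of_notMem_tsupport hx, zero_smul]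
  conv_rhs => rw [hsplit]
  simp only [divForm_add hfθ hfθ']
  rw [integral_add (integrable_divForm g hfθ hK fun x hx => by rw [h0 x hx, smul_zero])
    (integrable_divForm g hfθ' hK fun x hx => by rw [h0 x hx, smul_zero]), hzero, zero_add]

theorem exists_cutoff_integral_divForm_smul (g : Metric n M) {K : Set M} (hK : IsCompact K) :
    ∃ ρ : M → ℝ, (∀ x ∈ K, ρ x = 0) ∧ ∀ θ : OneForm n M, IsC1Form θ → (∀ x ∉ K, θ x = 0) →
      ∫ x, divForm g (fun x => ρ x • θ x) x ∂(riemannianVolume g) =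
        ∫ x, divForm g θ x ∂(riemannianVolume g) := by
  suffices ∃ ρ : M → ℝ, ContMDiff (𝓡 n) 𝓘(ℝ, ℝ) ∞ ρ ∧ (∀ x ∈ K, ρ x = 0) ∧
      ∀ θ : OneForm n M, IsC1Form θ → (∀ x ∉ K, θ x = 0) →
        ∫ x, divForm g (fun x => ρ x • θ x) x ∂(riemannianVolume g) =
          ∫ x, divForm g θ x ∂(riemannianVolume g) from this.imp fun _ => And.right
  refine hK.induction_on (p := fun s => ∃ ρ : M → ℝ, ContMDiff (𝓡 n) 𝓘(ℝ, ℝ) ∞ ρ ∧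
    (∀ x ∈ s, ρ x = 0) ∧ ∀ θ : OneForm n M, IsC1Form θ → (∀ x ∉ K, θ x = 0) →
      ∫ x, divForm g (fun x => ρ x • θ x) x ∂(riemannianVolume g) =
        ∫ x, divForm g θ x ∂(riemannianVolume g)) ?_ ?_ ?_ ?_
  · exact ⟨fun _ => 1, contMDiff_const, by simp, by simp⟩
  · rintro s t hst ⟨ρ, hρ, hρt, hρint⟩
    exact ⟨ρ, hρ, fun x hx => hρt x (hst hx), hρint⟩
  · rintro s t ⟨ρ, hρ, hρs, hρint⟩ ⟨σ, hσ, hσt, hρint'⟩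
    refine ⟨fun x => ρ x * σ x, hρ.mul hσ, ?_, fun θ hθ h0 => ?_⟩
    · rintro x (hx | hx)
      · exact mul_eq_zero_of_left (hρs x hx) _
      · exact mul_eq_zero_of_right _ (hσt x hx)
    · simp only [mul_smul]
      rw [hρint _ (hθ.smul hσ) fun x hx => by rw [h0 x hx, smul_zero], hρint' θ hθ h0]
  · intro p _
    obtain ⟨f⟩ : Nonempty (SmoothBumpFunction (𝓡 n) p) := inferInstance
    exact ⟨_, mem_nhdsWithin_of_mem_nhds f.eventuallyEq_one, fun x => 1 - f x,
      contMDiff_const.sub f.contMDiff, fun x hx => sub_eq_zero.2 hx.symm,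
      fun θ hθ h0 => integral_divForm_one_sub_smul g f hθ hK h0⟩

theorem integral_divForm_eq_zero (g : Metric n M) (hθ : IsC1Form θ) {K : Set M} (hK : IsCompact K)
    (h0 : ∀ x ∉ K, θ x = 0) : ∫ x, divForm g θ x ∂(riemannianVolume g) = 0 := by
  obtain ⟨ρ, hρK, hρ⟩ := exists_cutoff_integral_divForm_smul g hK
  have hcut : (fun x => ρ x • θ x) = 0 := funext fun x => by
    by_cases hx : x ∈ K
    · exact (congrArg (· • θ x) (hρK x hx)).trans (zero_smul ℝ _)
    · exact (congrArg (ρ x • ·) (h0 x hx)).trans (smul_zero _)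
  rw [← hρ θ hθ h0, hcut]
  simp only [divForm_zero, integral_zero]

end DivergenceTheorem

section CoordinateVariation

variable {n m : ℕ} {M : Type*} [TopologicalSpace M] [ChartedSpace (𝔼 n) M] [IsManifold (𝓡 n) ∞ M]
  {N : Type*} [TopologicalSpace N] [ChartedSpace (𝔼 m) N] [IsManifold (𝓡 m) ∞ N]
  {g : Metric n M} {h : Metric m N} {p : M} {q : N} {y : 𝔼 n} {t : ℝ}

/-- The 1-form `v ↦ h(W, u_* v)` attached to a map `u` and a vector field `W` along it, all written
in charts. -/
def fluxCoord (h : Metric m N) (q : N) (u W : (𝔼 n) → 𝔼 m) (z : 𝔼 n) : (𝔼 n) →L[ℝ] ℝ :=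
  (chartForm (metricTensor h) q (u z) (W z)).comp (fderiv ℝ u z)

theorem contDiffAt_fluxCoord {u W : (𝔼 n) → 𝔼 m} (hq : u y ∈ (extChartAt (𝓡 m) q).target)
    (hu : ContDiffAt ℝ 2 u y) (hW : ContDiffAt ℝ 1 W y) :
    ContDiffAt ℝ 1 (fluxCoord h q u W) y := by
  have hH : ContDiffAt ℝ 1 (fun z => chartForm (metricTensor h) q (u z)) y :=
    ((contDiffAt_chartForm_metric hq).of_le ENat.LEInfty.out).comp y (hu.of_le one_le_two)
  exact (hH.clm_apply hW).clm_comp (hu.fderiv_right le_rfl)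

theorem coordTrace_covDerivForm_fluxCoord {u W : (𝔼 n) → 𝔼 m}
    (hq : u y ∈ (extChartAt (𝓡 m) q).target) (hu : ContDiffAt ℝ 2 u y) (hW : ContDiffAt ℝ 1 W y) :
    coordTrace g p y (fun v w => covDerivForm g p (fluxCoord h q u W) y v w) =
      (coordTrace g p y fun v w => chartForm (metricTensor h) q (u y) (covDerivAlong h q u W y v)
        (fderiv ℝ u y w)) +
          chartForm (metricTensor h) q (u y) (W y) (tensionCoord g p h q u y) := by
  have hα := (contDiffAt_fluxCoord (h := h) hq hu hW).differentiableAt one_ne_zero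
  have hentry (v w : 𝔼 n) : covDerivForm g p (fluxCoord h q u W) y v w =
      chartForm (metricTensor h) q (u y) (covDerivAlong h q u W y v) (fderiv ℝ u y w) +
        chartForm (metricTensor h) q (u y) (W y) (secondForm g p h q u y v w) := by
    have hfderiv : fderiv ℝ (fluxCoord h q u W) y v w =
        fderiv ℝ (fun z => fluxCoord h q u W z w) y v := by
      simp [fderiv_clm_apply hα (differentiableAt_const w)]
    have hprod := fderiv_metric_along (h := h) hq (hu.differentiableAt two_ne_zero)
      (hW.differentiableAt one_ne_zero) (differentiableAt_fderiv_apply hu w) v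
    rw [covDerivForm_apply, hfderiv]
    refine (congrArg₂ (· - ·) hprod rfl).trans ?_
    simp only [fluxCoord, secondForm, ContinuousLinearMap.comp_apply, map_sub]
    ring
  simp only [hentry]
  rw [coordTrace_add, tensionCoord]
  exact congrArg (_ + ·)
    (map_coordTrace (chartForm (metricTensor h) q (u y) (W y)).toLinearMap _).symm

/-- The energy density of the maps `U (t, ·)`, written in charts. -/
def energyCoord (g : Metric n M) (p : M) (h : Metric m N) (q : N) (U : ℝ × (𝔼 n) → 𝔼 m)
    (w : ℝ × 𝔼 n) : ℝ :=
  coordTrace g p w.2 fun v v' =>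
    chartForm (metricTensor h) q (U w) (fderiv ℝ U w (0, v)) (fderiv ℝ U w (0, v'))

variable {U : ℝ × (𝔼 n) → 𝔼 m}

theorem contDiffAt_energyCoord {w : ℝ × 𝔼 n} (hy : w.2 ∈ (extChartAt (𝓡 n) p).target)
    (hq : U w ∈ (extChartAt (𝓡 m) q).target) (hU : ContDiffAt ℝ ∞ U w) :
    ContDiffAt ℝ ∞ (energyCoord g p h q U) w := by
  have hH : ContDiffAt ℝ ∞ (fun w => chartForm (metricTensor h) q (U w)) w :=
    (contDiffAt_chartForm_metric hq).comp w hU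
  have hdU (v : 𝔼 n) : ContDiffAt ℝ ∞ (fun w => fderiv ℝ U w (0, v)) w :=
    (hU.fderiv_right le_rfl).clm_apply contDiffAt_const
  have hinv (i j : Fin n) : ContDiffAt ℝ ∞ (fun w : ℝ × 𝔼 n => invCoeff g p w.2 i j) w :=
    (contDiffAt_invCoeff hy i j).comp w contDiffAt_snd
  unfold energyCoord coordTrace
  exact ContDiffAt.sum fun i _ => ContDiffAt.sum fun j _ =>
    (hinv i j).smul ((hH.clm_apply (hdU 𝐞[i])).clm_apply (hdU 𝐞[j]))

set_option synthInstance.maxHeartbeats 100000 in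
-- Normed-space instances on `(𝔼 m) →L[ℝ] (𝔼 m) →L[ℝ] ℝ` are slow to synthesize.
theorem hasDerivAt_energyCoord (hq : U (t, y) ∈ (extChartAt (𝓡 m) q).target)
    (hU : ContDiffAt ℝ 2 U (t, y)) :
    HasDerivAt (fun s => energyCoord g p h q U (s, y))
      (2 * coordTrace g p y fun v v' => chartForm (metricTensor h) q (U (t, y))
        (covDerivAlong h q U (fun w => fderiv ℝ U w (1, 0)) (t, y) (0, v))
          (fderiv ℝ U (t, y) (0, v'))) t := by
  set D : (𝔼 n) → 𝔼 m := fun v => covDerivAlong h q U (fun w => fderiv ℝ U w (1, 0)) (t, y) (0, v)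
  set H := chartForm (metricTensor h) q (U (t, y))
  have hU1 : DifferentiableAt ℝ U (t, y) := hU.differentiableAt two_ne_zero
  have hentry (v v' : 𝔼 n) : HasDerivAt (fun s => chartForm (metricTensor h) q (U (s, y))
      (fderiv ℝ U (s, y) (0, v)) (fderiv ℝ U (s, y) (0, v')))
      (H (D v) (fderiv ℝ U (t, y) (0, v')) + H (fderiv ℝ U (t, y) (0, v)) (D v')) t := by
    have hdU (v : 𝔼 n) := differentiableAt_fderiv_apply hU (0, v)
    have hdiff : DifferentiableAt ℝ (fun w => chartForm (metricTensor h) q (U w)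
        (fderiv ℝ U w (0, v)) (fderiv ℝ U w (0, v'))) (t, y) :=
      ((DifferentiableAt.comp (g := chartForm (metricTensor h) q) _
        (differentiableAt_chartForm_metric hq) hU1).clm_apply (hdU v)).clm_apply (hdU v')
    have hline := hdiff.hasFDerivAt.comp_hasDerivAt t
      ((hasDerivAt_id t).prodMk (hasDerivAt_const t y))
    rw [fderiv_metric_along hq hU1 (hdU v) (hdU v'), covDerivAlong_fderiv_comm hq hU _ (0, v),
      covDerivAlong_fderiv_comm hq hU _ (0, v')] at hline
    exact hline
  have hsum : HasDerivAt (fun s => energyCoord g p h q U (s, y)) (coordTrace g p y fun v v' =>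
      H (D v) (fderiv ℝ U (t, y) (0, v')) + H (fderiv ℝ U (t, y) (0, v)) (D v')) t := by
    simp only [energyCoord, coordTrace]
    exact HasDerivAt.fun_sum fun i _ => HasDerivAt.fun_sum fun j _ =>
      (hentry 𝐞[i] 𝐞[j]).fun_const_smul (invCoeff g p y i j)
  convert hsum using 1
  rw [coordTrace_add, ← coordTrace_swap fun v v' => H (fderiv ℝ U (t, y) (0, v)) (D v'), two_mul]
  simp only [H, D, chartForm_metric_symm h q (U (t, y)) (fderiv ℝ U (t, y) _)]

theorem fderiv_slice {A : ℝ × (𝔼 n) → 𝔼 m} (hA : DifferentiableAt ℝ A (t, y)) (v : 𝔼 n) :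
    fderiv ℝ (fun z => A (t, z)) y v = fderiv ℝ A (t, y) (0, v) := by
  rw [← Function.comp_def A, (hA.hasFDerivAt.comp y (hasFDerivAt_prodMk_right t y)).fderiv]
  rfl

theorem covDerivAlong_slice (hU : ContDiffAt ℝ 2 U (t, y)) (v : 𝔼 n) :
    covDerivAlong h q U (fun w => fderiv ℝ U w (1, 0)) (t, y) (0, v) =
      covDerivAlong h q (fun z => U (t, z)) (fun z => fderiv ℝ U (t, z) (1, 0)) y v := by
  rw [covDerivAlong, covDerivAlong, fderiv_slice (hU.differentiableAt two_ne_zero),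
    fderiv_slice (differentiableAt_fderiv_apply hU _)]

theorem hasDerivAt_energyCoord_eq_divergence (hq : U (t, y) ∈ (extChartAt (𝓡 m) q).target)
    (hU : ContDiffAt ℝ 2 U (t, y)) :
    HasDerivAt (fun s => energyCoord g p h q U (s, y))
      (2 * ((coordTrace g p y fun v w => covDerivForm g p
          (fluxCoord h q (fun z => U (t, z)) fun z => fderiv ℝ U (t, z) (1, 0)) y v w) -
        chartForm (metricTensor h) q (U (t, y)) (fderiv ℝ U (t, y) (1, 0))
          (tensionCoord g p h q (fun z => U (t, z)) y))) t := by
  have hslice : ContDiffAt ℝ 2 (fun z => U (t, z)) y :=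
    hU.comp y (contDiffAt_const.prodMk contDiffAt_id)
  have hvelocity : ContDiffAt ℝ 1 (fun z => fderiv ℝ U (t, z) (1, 0)) y :=
    ((hU.fderiv_right le_rfl).clm_apply contDiffAt_const).comp y
      (contDiffAt_const.prodMk contDiffAt_id)
  convert hasDerivAt_energyCoord hq hU using 2
  rw [coordTrace_covDerivForm_fluxCoord hq hslice hvelocity, add_sub_cancel_right]
  simp only [covDerivAlong_slice hU, fderiv_slice (hU.differentiableAt two_ne_zero)]

end CoordinateVariation

section TimeDerivative

variable {n : ℕ} {M : Type*} [TopologicalSpace M] [ChartedSpace (𝔼 n) M]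
  {A : ℝ × M → ℝ} {t : ℝ} {x : M}

theorem differentiableAt_slice (hA : ContMDiffAt (𝓘(ℝ, ℝ).prod (𝓡 n)) 𝓘(ℝ, ℝ) ∞ A (t, x)) :
    DifferentiableAt ℝ (fun s => A (s, x)) t := by
  have hcurve : ContMDiffAt 𝓘(ℝ, ℝ) 𝓘(ℝ, ℝ) ∞ (fun s => A (s, x)) t :=
    ContMDiffAt.comp (I' := 𝓘(ℝ, ℝ).prod (𝓡 n)) t hA (contMDiffAt_id.prodMk contMDiffAt_const)
  exact (hcurve.mdifferentiableAt (by simp)).differentiableAt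

theorem continuousAt_deriv_slice [IsManifold (𝓡 n) ∞ M]
    (hA : ContMDiffAt (𝓘(ℝ, ℝ).prod (𝓡 n)) 𝓘(ℝ, ℝ) ∞ A (t, x)) :
    ContinuousAt (fun w : ℝ × M => deriv (fun s => A (s, w.2)) w.1) (t, x) := by
  have hswap : ContMDiffAt ((𝓘(ℝ, ℝ).prod (𝓡 n)).prod 𝓘(ℝ, ℝ)) 𝓘(ℝ, ℝ) ∞
      (Function.uncurry fun (w : ℝ × M) s => A (s, w.2)) ((t, x), t) :=
    ContMDiffAt.comp (I' := 𝓘(ℝ, ℝ).prod (𝓡 n)) ((t, x), t) hA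
      (contMDiffAt_snd.prodMk (contMDiffAt_snd.comp _ contMDiffAt_fst))
  have hmfderiv := (ContMDiffAt.mfderiv (fun (w : ℝ × M) s => A (s, w.2)) Prod.fst hswap
    contMDiffAt_fst (m := 0) (by simp)).continuousAt
  simp only [inTangentCoordinates_model_space, mfderiv_eq_fderiv] at hmfderiv
  exact hmfderiv.clm_apply continuousAt_const

end TimeDerivative

section SmoothFamily

variable {n m : ℕ} {M : Type*} [TopologicalSpace M] [ChartedSpace (𝔼 n) M]
  {N : Type*} [TopologicalSpace N] [ChartedSpace (𝔼 m) N]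
  {p : M} {q : N} {y : 𝔼 n} {t ε : ℝ} {F : ℝ → M → N} {x : M}

/-- The families `(fₜ)` of maps, `-ε < t < ε`, that are smooth jointly in `t` and in the point. -/
def IsSmoothFamily (n m : ℕ) {M : Type*} [TopologicalSpace M] [ChartedSpace (𝔼 n) M]
    {N : Type*} [TopologicalSpace N] [ChartedSpace (𝔼 m) N] (ε : ℝ) (F : ℝ → M → N) : Prop :=
  ContMDiffOn (𝓘(ℝ, ℝ).prod (𝓡 n)) (𝓡 m) ∞ (fun w : ℝ × M => F w.1 w.2) (Ioo (-ε) ε ×ˢ univ)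

/-- The expression of a family of maps in the charts at `p` and `q`. -/
def familyRep (p : M) (q : N) (F : ℝ → M → N) (w : ℝ × 𝔼 n) : 𝔼 m :=
  localRep p q (F w.1) w.2

/-- The velocity `∂fₜ/∂t` at time `0` of a family of maps, a vector field along `f₀`. -/
def variationField (F : ℝ → M → N) (x : M) : TangentSpace (𝓡 m) (F 0 x) :=
  mfderiv 𝓘(ℝ, ℝ) (𝓡 m) (fun t => F t x) 0 (1 : ℝ)

theorem IsSmoothFamily.contMDiffAt (hF : IsSmoothFamily n m ε F) (ht : t ∈ Ioo (-ε) ε) (x : M) :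
    ContMDiffAt (𝓘(ℝ, ℝ).prod (𝓡 n)) (𝓡 m) ∞ (fun w : ℝ × M => F w.1 w.2) (t, x) :=
  ContMDiffOn.contMDiffAt hF (prod_mem_nhds (isOpen_Ioo.mem_nhds ht) Filter.univ_mem)

theorem IsSmoothFamily.contMDiff (hF : IsSmoothFamily n m ε F) (ht : t ∈ Ioo (-ε) ε) :
    ContMDiff (𝓡 n) (𝓡 m) ∞ (F t) := fun x =>
  ContMDiffAt.comp (I' := 𝓘(ℝ, ℝ).prod (𝓡 n)) (f := fun x : M => (t, x)) x (hF.contMDiffAt ht x)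
    (contMDiffAt_const.prodMk contMDiffAt_id)

variable [IsManifold (𝓡 n) ∞ M]

theorem IsSmoothFamily.eventually_mem_source (hF : IsSmoothFamily n m ε F)
    (ht : t ∈ Ioo (-ε) ε) (hy : y ∈ (extChartAt (𝓡 n) p).target)
    (hq : F t ((extChartAt (𝓡 n) p).symm y) ∈ (extChartAt (𝓡 m) q).source) :
    ∀ᶠ z in 𝓝 y, z ∈ (extChartAt (𝓡 n) p).target ∧
      F t ((extChartAt (𝓡 n) p).symm z) ∈ (extChartAt (𝓡 m) q).source :=
  ((isOpen_extChartAt_target p).eventually_mem hy).and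
    (((hF.contMDiff ht).continuous.continuousAt.comp
      (contMDiffAt_chart_symm hy).continuousAt).eventually
        ((isOpen_extChartAt_source q).eventually_mem hq))

variable [IsManifold (𝓡 m) ∞ N]

theorem IsSmoothFamily.contDiffAt_familyRep (hF : IsSmoothFamily n m ε F) (ht : t ∈ Ioo (-ε) ε)
    (hy : y ∈ (extChartAt (𝓡 n) p).target)
    (hq : F t ((extChartAt (𝓡 n) p).symm y) ∈ (extChartAt (𝓡 m) q).source) :
    ContDiffAt ℝ ∞ (familyRep p q F : ℝ × (𝔼 n) → 𝔼 m) (t, y) := by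
  have hchart : ContMDiffAt (𝓘(ℝ, ℝ).prod 𝓘(ℝ, 𝔼 n)) (𝓘(ℝ, ℝ).prod (𝓡 n)) ∞
      (fun w : ℝ × (𝔼 n) => (w.1, (extChartAt (𝓡 n) p).symm w.2)) (t, y) :=
    contMDiffAt_fst.prodMk ((contMDiffAt_chart_symm hy).comp (t, y) contMDiffAt_snd)
  have hcomp : ContMDiffAt (𝓘(ℝ, ℝ).prod 𝓘(ℝ, 𝔼 n)) 𝓘(ℝ, 𝔼 m) ∞
      (familyRep p q F : ℝ × (𝔼 n) → 𝔼 m) (t, y) :=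
    (contMDiffAt_chart hq).comp (t, y) (ContMDiffAt.comp (I' := 𝓘(ℝ, ℝ).prod (𝓡 n))
      (g := fun w : ℝ × M => F w.1 w.2) (t, y) (hF.contMDiffAt ht _) hchart)
  rw [← contMDiffAt_iff_contDiffAt]
  rwa [← modelWithCornersSelf_prod, chartedSpaceSelf_prod] at hcomp

theorem variationField_eq_coordFrame (hε : 0 < ε) (hF : IsSmoothFamily n m ε F)
    (hy : y ∈ (extChartAt (𝓡 n) p).target)
    (hq : F 0 ((extChartAt (𝓡 n) p).symm y) ∈ (extChartAt (𝓡 m) q).source) :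
    (variationField F ((extChartAt (𝓡 n) p).symm y) : 𝔼 m) =
      coordFrame q (extChartAt (𝓡 m) q (F 0 ((extChartAt (𝓡 n) p).symm y)))
        (fderiv ℝ (familyRep p q F) (0, y) (1, 0)) := by
  have h0 : (0 : ℝ) ∈ Ioo (-ε) ε := ⟨neg_lt_zero.2 hε, hε⟩
  have hcurve : MDifferentiableAt 𝓘(ℝ, ℝ) (𝓡 m)
      (fun t => F t ((extChartAt (𝓡 n) p).symm y)) 0 :=
    (ContMDiffAt.comp (I' := 𝓘(ℝ, ℝ).prod (𝓡 n)) (g := fun w : ℝ × M => F w.1 w.2)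
      (f := fun t : ℝ => (t, (extChartAt (𝓡 n) p).symm y)) 0
      (hF.contMDiffAt h0 _) (contMDiffAt_id.prodMk contMDiffAt_const)).mdifferentiableAt (by simp)
  have hline := ((hF.contDiffAt_familyRep h0 hy hq).differentiableAt (by simp)).hasFDerivAt.comp
    (f := fun s : ℝ => (s, y)) (0 : ℝ) (hasFDerivAt_prodMk_left (𝕜 := ℝ) (0 : ℝ) y)
  refine (coordFrame_mfderiv_chart hq _).symm.trans (congrArg (coordFrame q _) ?_)
  have hchain := mfderiv_comp (0 : ℝ) ((contMDiffAt_chart hq).mdifferentiableAt (by simp)) hcurve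
  refine (DFunLike.congr_fun hchain (1 : ℝ)).symm.trans ?_
  rw [mfderiv_eq_fderiv]
  exact DFunLike.congr_fun hline.fderiv (1 : ℝ)

variable {g : Metric n M} {h : Metric m N}

theorem IsSmoothFamily.energyDensity_eq_energyCoord (hF : IsSmoothFamily n m ε F)
    (ht : t ∈ Ioo (-ε) ε) (hy : y ∈ (extChartAt (𝓡 n) p).target)
    (hq : F t ((extChartAt (𝓡 n) p).symm y) ∈ (extChartAt (𝓡 m) q).source) :
    energyDensity g h (F t) ((extChartAt (𝓡 n) p).symm y) =
      energyCoord g p h q (familyRep p q F) (t, y) := by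
  have hU := (hF.contDiffAt_familyRep ht hy hq).differentiableAt (by simp)
  rw [energyDensity_chart g h (F t) hy]
  simp only [chartForm_pullbackMetric h hy (hF.contMDiff ht _) hq, energyCoord, ← fderiv_slice hU]
  rfl

theorem IsSmoothFamily.contMDiffAt_energyDensity (g : Metric n M) (h : Metric m N)
    (hF : IsSmoothFamily n m ε F) (ht : t ∈ Ioo (-ε) ε) (x : M) :
    ContMDiffAt (𝓘(ℝ, ℝ).prod (𝓡 n)) 𝓘(ℝ, ℝ) ∞
      (fun w : ℝ × M => energyDensity g h (F w.1) w.2) (t, x) := by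
  have hx := mem_extChartAt_source (I := 𝓡 n) x
  have hq : F t ((extChartAt (𝓡 n) x).symm (extChartAt (𝓡 n) x x)) ∈
      (extChartAt (𝓡 m) (F t x)).source := by
    rw [extChartAt_to_inv]; exact mem_extChartAt_source _
  have hchart : ContMDiffAt (𝓘(ℝ, ℝ).prod (𝓡 n)) 𝓘(ℝ, ℝ × 𝔼 n) ∞
      (fun w : ℝ × M => (w.1, extChartAt (𝓡 n) x w.2)) (t, x) :=
    contMDiffAt_fst.prodMk_space ((contMDiffAt_chart hx).comp (t, x) contMDiffAt_snd)
  have hcoord : ContDiffAt ℝ ∞ (energyCoord g x h (F t x) (familyRep x (F t x) F))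
      (t, extChartAt (𝓡 n) x x) :=
    contDiffAt_energyCoord (mem_extChartAt_target x) ((extChartAt (𝓡 m) (F t x)).map_source hq)
      (hF.contDiffAt_familyRep ht (mem_extChartAt_target x) hq)
  refine (hcoord.contMDiffAt.comp (t, x) hchart).congr_of_eventuallyEq ?_
  filter_upwards [continuousAt_fst.eventually (isOpen_Ioo.eventually_mem ht),
    continuousAt_snd.eventually ((isOpen_extChartAt_source x).eventually_mem hx),
    (hF.contMDiffAt ht x).continuousAt.eventually
      ((isOpen_extChartAt_source (I := 𝓡 m) (F t x)).eventually_mem (mem_extChartAt_source _))]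
    with w hw hwx hwq
  have hl := (extChartAt (𝓡 n) x).left_inv hwx
  have := hF.energyDensity_eq_energyCoord (g := g) (h := h) (q := F t x) hw
    ((extChartAt (𝓡 n) x).map_source hwx) (by rwa [hl])
  rwa [hl] at this

end SmoothFamily

section Flux

variable {n m : ℕ} {M : Type*} [TopologicalSpace M] [ChartedSpace (𝔼 n) M] [IsManifold (𝓡 n) ∞ M]
  {N : Type*} [TopologicalSpace N] [ChartedSpace (𝔼 m) N] [IsManifold (𝓡 m) ∞ N]
  {g : Metric n M} {h : Metric m N} {p : M} {q : N} {y : 𝔼 n} {ε : ℝ} {F : ℝ → M → N}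

/-- The 1-form `Y ↦ h(V, f_* Y)` attached to a vector field `V` along `f`. -/
def fluxForm (h : Metric m N) (f : M → N) (V : (x : M) → TangentSpace (𝓡 m) (f x)) :
    OneForm n M := fun x =>
  (h.inner (f x) (V x)).comp (mfderiv (𝓡 n) (𝓡 m) f x)

theorem chartCovector_fluxForm (hε : 0 < ε) (hF : IsSmoothFamily n m ε F)
    (hy : y ∈ (extChartAt (𝓡 n) p).target)
    (hq : F 0 ((extChartAt (𝓡 n) p).symm y) ∈ (extChartAt (𝓡 m) q).source) :
    chartCovector (fluxForm h (F 0) (variationField F)) p y =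
      fluxCoord h q (localRep p q (F 0)) (fun z => fderiv ℝ (familyRep p q F) (0, z) (1, 0)) y := by
  have h0 : (0 : ℝ) ∈ Ioo (-ε) ε := ⟨neg_lt_zero.2 hε, hε⟩
  ext v
  refine (congrArg₂ (fun a b => h.inner (F 0 ((extChartAt (𝓡 n) p).symm y)) a b)
    (variationField_eq_coordFrame hε hF hy hq)
    (mfderiv_coordFrame hy (hF.contMDiff h0 _) hq v)).trans ?_
  exact tensor2_coordFrame (metricTensor h) hq _ _

theorem isC1Form_fluxForm (h : Metric m N) (hε : 0 < ε) (hF : IsSmoothFamily n m ε F) :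
    IsC1Form (fluxForm (n := n) h (F 0) (variationField F)) := by
  intro p y hy
  have h0 : (0 : ℝ) ∈ Ioo (-ε) ε := ⟨neg_lt_zero.2 hε, hε⟩
  have hq := mem_extChartAt_source (I := 𝓡 m) (F 0 ((extChartAt (𝓡 n) p).symm y))
  set q := F 0 ((extChartAt (𝓡 n) p).symm y)
  have hU := hF.contDiffAt_familyRep h0 hy hq
  have hvelocity : ContDiffAt ℝ 1 (fun z => fderiv ℝ (familyRep p q F) (0, z) (1, 0)) y :=
    (((hU.of_le (m := 2) ENat.LEInfty.out).fderiv_right (m := 1) le_rfl).clm_apply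
      contDiffAt_const).comp y (contDiffAt_const.prodMk contDiffAt_id)
  refine (contDiffAt_fluxCoord (h := h) (localRep_mem_target hq)
    ((contDiffAt_localRep hy (hF.contMDiff h0 _) hq).of_le ENat.LEInfty.out)
    hvelocity).congr_of_eventuallyEq ?_
  filter_upwards [hF.eventually_mem_source h0 hy hq] with z hz
  exact chartCovector_fluxForm hε hF hz.1 hz.2

theorem covDerivForm_congr {α β : (𝔼 n) → (𝔼 n) →L[ℝ] ℝ} (hαβ : α =ᶠ[𝓝 y] β) :
    covDerivForm g p α y = covDerivForm g p β y := by
  ext v w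
  rw [covDerivForm_apply, covDerivForm_apply, hαβ.fderiv_eq, hαβ.eq_of_nhds]

theorem inner_variationField_tension (g : Metric n M) (h : Metric m N) (hε : 0 < ε)
    (hF : IsSmoothFamily n m ε F) (x : M) :
    h.inner (F 0 x) (variationField F x) (tension g h (F 0) x) =
      chartForm (metricTensor h) (F 0 x) (localRep x (F 0 x) (F 0) (extChartAt (𝓡 n) x x))
        (fderiv ℝ (familyRep x (F 0 x) F) (0, extChartAt (𝓡 n) x x) (1, 0))
          (tensionCoord g x h (F 0 x) (localRep x (F 0 x) (F 0)) (extChartAt (𝓡 n) x x)) := by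
  have hx := extChartAt_to_inv (I := 𝓡 n) x
  have hq := mem_extChartAt_source (I := 𝓡 m) (F 0 x)
  have hvelocity : (variationField F x : 𝔼 m) =
    coordFrame (F 0 x) (extChartAt (𝓡 m) (F 0 x) (F 0 x))
      (fderiv ℝ (familyRep x (F 0 x) F) (0, extChartAt (𝓡 n) x x) (1, 0)) := by
    have := variationField_eq_coordFrame (q := F 0 x) hε hF (mem_extChartAt_target x) (by rwa [hx])
    rwa [hx] at this
  rw [localRep_center, ← tensor2_coordFrame _ hq]
  exact congrArg₂ (fun a b => h.inner (F 0 x) a b) hvelocity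
    (tension_eq_coordFrame (hF.contMDiff ⟨neg_lt_zero.2 hε, hε⟩ x))

theorem hasDerivAt_energyDensity (g : Metric n M) (h : Metric m N) (hε : 0 < ε)
    (hF : IsSmoothFamily n m ε F) (x : M) :
    HasDerivAt (fun t => energyDensity g h (F t) x)
      (2 * (divForm g (fluxForm h (F 0) (variationField F)) x -
        h.inner (F 0 x) (variationField F x) (tension g h (F 0) x))) 0 := by
  have h0 : (0 : ℝ) ∈ Ioo (-ε) ε := ⟨neg_lt_zero.2 hε, hε⟩
  have hy := mem_extChartAt_target (I := 𝓡 n) x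
  have hx := extChartAt_to_inv (I := 𝓡 n) x
  set y := extChartAt (𝓡 n) x x
  set q := F 0 x
  have hq : F 0 ((extChartAt (𝓡 n) x).symm y) ∈ (extChartAt (𝓡 m) q).source := by
    rw [hx]; exact mem_extChartAt_source q
  have hU := hF.contDiffAt_familyRep h0 hy hq
  have hcoord := hasDerivAt_energyCoord_eq_divergence (g := g) (h := h) (p := x) (q := q)
    (localRep_mem_target hq) (hU.of_le ENat.LEInfty.out)
  have hdiv : divForm g (fluxForm h (F 0) (variationField F)) x = coordTrace g x y fun v w =>
      covDerivForm g x (fluxCoord h q (localRep x q (F 0))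
        fun z => fderiv ℝ (familyRep x q F) (0, z) (1, 0)) y v w := by
    have hflux := (hF.eventually_mem_source h0 hy hq).mono fun z hz =>
      chartCovector_fluxForm (h := h) hε hF hz.1 hz.2
    rw [divForm, covDerivForm_congr hflux]
  rw [hdiv, inner_variationField_tension g h hε hF x]
  refine hcoord.congr_of_eventuallyEq ?_
  have hcurve : ContinuousAt (fun t => F t ((extChartAt (𝓡 n) x).symm y)) 0 :=
    ContinuousAt.comp (g := fun w : ℝ × M => F w.1 w.2)
      (f := fun t : ℝ => (t, (extChartAt (𝓡 n) x).symm y))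
      (hF.contMDiffAt h0 _).continuousAt (by fun_prop)
  filter_upwards [isOpen_Ioo.eventually_mem h0,
    hcurve.eventually ((isOpen_extChartAt_source q).eventually_mem hq)] with t ht htq
  rw [← hF.energyDensity_eq_energyCoord ht hy htq, hx]

end Flux

section FirstVariation

variable {n m : ℕ} {M N : Type*} [TopologicalSpace N] [ChartedSpace (𝔼 m) N] {F : ℝ → M → N}
  {x : M}

theorem variationField_eq_zero (hx : ∀ᶠ t in 𝓝 (0 : ℝ), F t x = F 0 x) :
    variationField (m := m) F x = 0 := by
  have hconst : mfderiv 𝓘(ℝ, ℝ) (𝓡 m) (fun t => F t x) 0 =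
      (mfderiv 𝓘(ℝ, ℝ) (𝓡 m) (fun _ : ℝ => F 0 x) 0 : ℝ →L[ℝ] 𝔼 m) :=
    Filter.EventuallyEq.mfderiv_eq hx
  rw [mfderiv_const] at hconst
  exact DFunLike.congr_fun hconst (1 : ℝ)

variable [TopologicalSpace M] [ChartedSpace (𝔼 n) M] [IsManifold (𝓡 n) ∞ M] [IsManifold (𝓡 m) ∞ N]
  {f : M → N} {U : Set M} {ε : ℝ}

theorem IsSmoothFamily.continuous_inner_variationField_tension (g : Metric n M) (h : Metric m N)
    (hε : 0 < ε) (hF : IsSmoothFamily n m ε F) :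
    Continuous fun x => h.inner (F 0 x) (variationField F x) (tension g h (F 0) x) := by
  have hderiv : Continuous fun x => deriv (fun t => energyDensity g h (F t) x) 0 :=
    continuous_iff_continuousAt.2 fun x => ContinuousAt.comp
      (g := fun w : ℝ × M => deriv (fun t => energyDensity g h (F t) w.2) w.1)
      (f := fun z : M => ((0 : ℝ), z))
      (continuousAt_deriv_slice (hF.contMDiffAt_energyDensity g h ⟨neg_lt_zero.2 hε, hε⟩ x))
      (by fun_prop)
  refine ((continuous_divForm g (isC1Form_fluxForm h hε hF)).sub
    (hderiv.div_const 2)).congr fun x => ?_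
  simp only [Pi.sub_apply, (hasDerivAt_energyDensity g h hε hF x).deriv]
  ring

variable [T2Space M] [MeasurableSpace M] [BorelSpace M]

theorem IsSmoothFamily.hasDerivAt_energy (g : Metric n M) (h : Metric m N) (hε : 0 < ε)
    (hF : IsSmoothFamily n m ε F) (hU : IsOpen U) (hUc : IsCompact (closure U)) :
    HasDerivAt (fun t => energy g h U (F t))
      (∫ x in U, (divForm g (fluxForm h (F 0) (variationField F)) x -
        h.inner (F 0 x) (variationField F x) (tension g h (F 0) x)) ∂(riemannianVolume g)) 0 := by
  have h0 : (0 : ℝ) ∈ Ioo (-ε) ε := ⟨neg_lt_zero.2 hε, hε⟩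
  have hsub : Icc (-(ε / 2)) (ε / 2) ⊆ Ioo (-ε) ε := Icc_subset_Ioo (by linarith) (by linarith)
  have hcont : ∀ t ∈ Ioo (-ε) ε, Continuous (energyDensity g h (F t)) := fun t ht =>
    continuous_iff_continuousAt.2 fun x => ContinuousAt.comp
      (g := fun w : ℝ × M => energyDensity g h (F w.1) w.2) (f := fun z : M => (t, z))
      (hF.contMDiffAt_energyDensity g h ht x).continuousAt (by fun_prop)
  obtain ⟨B, hB⟩ := (isCompact_Icc.prod hUc).exists_bound_of_continuousOn
    (f := fun w : ℝ × M => deriv (fun s => energyDensity g h (F s) w.2) w.1) fun w hw =>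
      (continuousAt_deriv_slice
        (hF.contMDiffAt_energyDensity g h (hsub hw.1) w.2)).continuousWithinAt
  have hfinite : riemannianVolume g U < ⊤ :=
    (measure_mono subset_closure).trans_lt hUc.measure_lt_top
  have hparam := (hasDerivAt_integral_of_dominated_loc_of_deriv_le
    (μ := (riemannianVolume g).restrict U) (s := Icc (-(ε / 2)) (ε / 2)) (bound := fun _ => B)
    (F := fun t x => energyDensity g h (F t) x)
    (F' := fun t x => deriv (fun s => energyDensity g h (F s) x) t)
    (Icc_mem_nhds (by linarith) (by linarith))
    ((isOpen_Ioo.eventually_mem h0).mono fun t ht => (hcont t ht).aestronglyMeasurable)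
    (((hcont 0 h0).continuousOn.integrableOn_compact hUc).mono_set subset_closure)
    (((continuous_divForm g (isC1Form_fluxForm h hε hF)).sub
      (hF.continuous_inner_variationField_tension g h hε)).const_mul 2 |>.congr fun x =>
        (hasDerivAt_energyDensity g h hε hF x).deriv.symm).aestronglyMeasurable
    ((ae_restrict_mem hU.measurableSet).mono fun x hx t ht => hB (t, x) ⟨ht, subset_closure hx⟩)
    (integrableOn_const hfinite.ne)
    (Filter.Eventually.of_forall fun x t ht => (differentiableAt_slice
      (hF.contMDiffAt_energyDensity g h (hsub ht) x)).hasDerivAt)).2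
  refine (hparam.const_mul (1 / 2)).congr_deriv ?_
  simp only [(hasDerivAt_energyDensity g h hε hF _).deriv, integral_const_mul]
  ring

theorem IsVariation.hasDerivAt_energy (g : Metric n M) (h : Metric m N) (hε : 0 < ε)
    (hF : IsVariation n m f U ε F) (hU : IsOpen U) (hUc : IsCompact (closure U)) :
    HasDerivAt (fun t => energy g h U (F t))
      (-∫ x, h.inner (F 0 x) (variationField F x) (tension g h (F 0) x) ∂(riemannianVolume g))
      0 := by
  obtain ⟨K, hK, hKU, hKF⟩ := hF.support
  have hsmooth : IsSmoothFamily n m ε F := hF.smooth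
  have hform := isC1Form_fluxForm (n := n) h hε hsmooth
  have hzero : ∀ x ∉ K, variationField (m := m) F x = 0 := fun x hx =>
    variationField_eq_zero <| (isOpen_Ioo.eventually_mem ⟨neg_lt_zero.2 hε, hε⟩).mono fun t ht => by
      rw [hKF t ht x hx, hF.initial]
  have hflux : ∀ x ∉ K, fluxForm (n := n) h (F 0) (variationField F) x = 0 := fun x hx => by
    simp [fluxForm, hzero x hx]
  have hpairing : ∀ x ∉ K,
      h.inner (F 0 x) (variationField F x) (tension g h (F 0) x) = 0 := fun x hx => by
    simp [hzero x hx]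
  have hintegrable : Integrable
      (fun x => h.inner (F 0 x) (variationField F x) (tension g h (F 0) x)) (riemannianVolume g) :=
    (hsmooth.continuous_inner_variationField_tension g h hε).integrable_of_hasCompactSupport
      (HasCompactSupport.intro hK hpairing)
  refine (hsmooth.hasDerivAt_energy g h hε hU hUc).congr_deriv ?_
  rw [setIntegral_eq_integral_of_forall_compl_eq_zero fun x hx => ?_,
    integral_sub (integrable_divForm g hform hK hflux) hintegrable,
    integral_divForm_eq_zero g hform hK hflux, zero_sub]
  have hxK : x ∉ K := fun hxK => hx (hKU hxK)
  rw [divForm_eq_zero hK.isClosed hflux hxK, hpairing x hxK, sub_zero]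

end FirstVariation

section ChartVariation

variable {n m : ℕ} {M : Type*} {N : Type*} [TopologicalSpace N] [ChartedSpace (𝔼 m) N]
  {q : N} {f : M → N} {χ : M → ℝ} {v : 𝔼 m} {t : ℝ} {z : M}

/-- The straight segments `ψ(f) + t χ v` in the chart `ψ` at `q`, starting from a map `f` at
`t = 0`; the cutoff function `χ` keeps them constant outside its support. -/
def chartSegment (q : N) (f : M → N) (χ : M → ℝ) (v : 𝔼 m) (w : ℝ × M) : 𝔼 m :=
  extChartAt (𝓡 m) q (f w.2) + (w.1 * χ w.2) • v

open Classical in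
/-- The variation of `f` along the segments `chartSegment q f χ v`, constant where `f` leaves the
chart at `q`. -/
def chartVariation (q : N) (f : M → N) (χ : M → ℝ) (v : 𝔼 m) (t : ℝ) (z : M) : N :=
  if f z ∈ (extChartAt (𝓡 m) q).source then
    (extChartAt (𝓡 m) q).symm (chartSegment q f χ v (t, z))
  else f z

theorem chartVariation_of_mem (hz : f z ∈ (extChartAt (𝓡 m) q).source) :
    chartVariation q f χ v t z = (extChartAt (𝓡 m) q).symm (chartSegment q f χ v (t, z)) :=
  if_pos hz

theorem chartVariation_of_mul_eq_zero (hz : t * χ z = 0) : chartVariation q f χ v t z = f z := by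
  by_cases hq : f z ∈ (extChartAt (𝓡 m) q).source
  · rw [chartVariation_of_mem hq, chartSegment, hz, zero_smul, add_zero,
      (extChartAt (𝓡 m) q).left_inv hq]
  · exact if_neg hq

theorem chartVariation_zero : chartVariation q f χ v 0 = f :=
  funext fun _ => chartVariation_of_mul_eq_zero (zero_mul _)

variable [IsManifold (𝓡 m) ∞ N]

/-- The coordinate vector field with constant components `v` in the chart at `q`, along `f`. -/
def frameAlong (q : N) (v : 𝔼 m) (f : M → N) (z : M) : TangentSpace (𝓡 m) (f z) :=
  coordFrame q (extChartAt (𝓡 m) q (f z)) v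

theorem variationField_chartVariation (hz : χ z ≠ 0 → f z ∈ (extChartAt (𝓡 m) q).source) :
    (variationField (chartVariation q f χ v) z : 𝔼 m) = χ z • (frameAlong q v f z : 𝔼 m) := by
  rcases eq_or_ne (χ z) 0 with hχ | hχ
  · rw [hχ, zero_smul]
    exact variationField_eq_zero (Filter.Eventually.of_forall fun t => by
      rw [chartVariation_zero, chartVariation_of_mul_eq_zero (mul_eq_zero_of_right t hχ)])
  have hq := hz hχ
  have hstart : chartSegment q f χ v (0, z) = extChartAt (𝓡 m) q (f z) := by
    rw [chartSegment, zero_mul, zero_smul, add_zero]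
  have hline : HasDerivAt (fun t => chartSegment q f χ v (t, z)) ((1 * χ z) • v) 0 :=
    (((hasDerivAt_id (0 : ℝ)).mul_const (χ z)).smul_const v).const_add (extChartAt (𝓡 m) q (f z))
  have hsymm : HasMFDerivAt 𝓘(ℝ, 𝔼 m) (𝓡 m) (extChartAt (𝓡 m) q).symm
      (chartSegment q f χ v (0, z)) (coordFrame q (chartSegment q f χ v (0, z))) :=
    ((contMDiffAt_chart_symm (hstart ▸ (extChartAt (𝓡 m) q).map_source hq)).mdifferentiableAt
      (by simp)).hasMFDerivAt
  have hcurve := (hsymm.comp (0 : ℝ) hline.hasFDerivAt.hasMFDerivAt).congr_of_eventuallyEq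
    (Filter.Eventually.of_forall fun t => chartVariation_of_mem (t := t) hq)
  refine (DFunLike.congr_fun hcurve.mfderiv (1 : ℝ)).trans ?_
  change (coordFrame q (chartSegment q f χ v (0, z)) ((1 : ℝ) • (1 * χ z) • v) : 𝔼 m) = _
  rw [hstart, one_smul, one_mul]
  exact map_smul _ _ _

variable [TopologicalSpace M] [ChartedSpace (𝔼 n) M]

theorem contMDiffAt_chartSegment (hf : ContMDiff (𝓡 n) (𝓡 m) ∞ f)
    (hχ : ContMDiff (𝓡 n) 𝓘(ℝ, ℝ) ∞ χ) (hz : f z ∈ (extChartAt (𝓡 m) q).source) :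
    ContMDiffAt (𝓘(ℝ, ℝ).prod (𝓡 n)) 𝓘(ℝ, 𝔼 m) ∞ (chartSegment q f χ v) (t, z) :=
  (ContMDiffAt.comp (g := fun z => extChartAt (𝓡 m) q (f z)) (t, z)
    ((contMDiffAt_chart hz).comp z (hf z)) contMDiffAt_snd).add
    ((contMDiffAt_fst.mul (ContMDiffAt.comp (t, z) (hχ z) contMDiffAt_snd)).smul
      contMDiffAt_const)

theorem exists_chartSegment_mem_target (v : 𝔼 m) (hf : ContMDiff (𝓡 n) (𝓡 m) ∞ f)
    (hχ : ContMDiff (𝓡 n) 𝓘(ℝ, ℝ) ∞ χ) (hcompact : HasCompactSupport χ)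
    (hsupp : tsupport χ ⊆ f ⁻¹' (extChartAt (𝓡 m) q).source) :
    ∃ ε > 0, ∀ t ∈ Ioo (-ε) ε, ∀ z ∈ tsupport χ,
      chartSegment q f χ v (t, z) ∈ (extChartAt (𝓡 m) q).target := by
  have hnear : ∀ᶠ t in 𝓝 (0 : ℝ), ∀ z ∈ tsupport χ,
      chartSegment q f χ v (t, z) ∈ (extChartAt (𝓡 m) q).target :=
    hcompact.isCompact.eventually_forall_of_forall_eventually fun z hz =>
      (contMDiffAt_chartSegment hf hχ (hsupp hz)).continuousAt.eventually
        ((isOpen_extChartAt_target q).eventually_mem (by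
          rw [chartSegment, zero_mul, zero_smul, add_zero]
          exact (extChartAt (𝓡 m) q).map_source (hsupp hz)))
  obtain ⟨ε, hε, hball⟩ := Metric.eventually_nhds_iff.1 hnear
  exact ⟨ε, hε, fun t ht => hball (by rwa [Real.dist_0_eq_abs, abs_lt])⟩

theorem exists_isVariation_chartVariation (v : 𝔼 m) (hf : ContMDiff (𝓡 n) (𝓡 m) ∞ f)
    (hχ : ContMDiff (𝓡 n) 𝓘(ℝ, ℝ) ∞ χ) (hcompact : HasCompactSupport χ)
    (hsupp : tsupport χ ⊆ f ⁻¹' (extChartAt (𝓡 m) q).source) :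
    ∃ ε > 0, ∀ U, tsupport χ ⊆ U → IsVariation n m f U ε (chartVariation q f χ v) := by
  obtain ⟨ε, hε, htarget⟩ := exists_chartSegment_mem_target v hf hχ hcompact hsupp
  refine ⟨ε, hε, fun U hU => ⟨?_, chartVariation_zero, tsupport χ, hcompact, hU, fun t _ z hz =>
    chartVariation_of_mul_eq_zero (by rw [image_eq_zero_of_notMem_tsupport hz, mul_zero])⟩⟩
  rintro ⟨t, z⟩ ⟨ht, -⟩
  by_cases hz : z ∈ tsupport χ
  · refine ((ContMDiffAt.comp (t, z) (contMDiffAt_chart_symm (htarget t ht z hz))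
      (contMDiffAt_chartSegment hf hχ (hsupp hz))).congr_of_eventuallyEq ?_).contMDiffWithinAt
    filter_upwards [continuousAt_snd.eventually
      (((isOpen_extChartAt_source q).preimage hf.continuous).eventually_mem (hsupp hz))] with w hw
    exact chartVariation_of_mem hw
  · refine ((ContMDiffAt.comp (t, z) (hf z) contMDiffAt_snd).congr_of_eventuallyEq
      ?_).contMDiffWithinAt
    filter_upwards [continuousAt_snd.eventually (notMem_tsupport_iff_eventuallyEq.1 hz)] with w hw
    exact chartVariation_of_mul_eq_zero (mul_eq_zero_of_right _ hw)

theorem inner_variationField_chartVariation [IsManifold (𝓡 n) ∞ M] (g : Metric n M)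
    (h : Metric m N) (hz : χ z ≠ 0 → f z ∈ (extChartAt (𝓡 m) q).source) :
    h.inner (chartVariation q f χ v 0 z) (variationField (chartVariation q f χ v) z)
      (tension g h (chartVariation q f χ v 0) z) =
        χ z * h.inner (f z) (frameAlong q v f z) (tension g h f z) := by
  have hbase : ∀ f' : M → N, f' = f → ∀ V : 𝔼 m,
      h.inner (f' z) V (tension g h f' z) = h.inner (f z) V (tension g h f z) := by
    rintro _ rfl _
    rfl
  refine (hbase _ chartVariation_zero _).trans ?_
  refine (congrArg (fun V : 𝔼 m => h.inner (f z) V (tension g h f z))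
    (variationField_chartVariation hz)).trans ?_
  exact congrArg (fun l : _ →L[ℝ] ℝ => l (tension g h f z))
    ((h.inner (f z)).map_smul (χ z) (frameAlong q v f z))

end ChartVariation

section EulerLagrange

variable {n m : ℕ} {M : Type*} [TopologicalSpace M] [ChartedSpace (𝔼 n) M] [IsManifold (𝓡 n) ∞ M]
  [T2Space M] [MeasurableSpace M] [BorelSpace M]
  {N : Type*} [TopologicalSpace N] [ChartedSpace (𝔼 m) N] [IsManifold (𝓡 m) ∞ N]
  {g : Metric n M} {h : Metric m N} {f : M → N}

theorem isHarmonic_of_tension_eq_zero (g : Metric n M) (h : Metric m N)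
    (hf : ContMDiff (𝓡 n) (𝓡 m) ∞ f) (hτ : ∀ x, tension g h f x = 0) : IsHarmonic g h f := by
  refine ⟨hf, fun U hU hUc ε hε F hF => ?_⟩
  obtain rfl := hF.initial
  simpa only [hτ, map_zero, integral_zero, neg_zero] using hF.hasDerivAt_energy g h hε hU hUc

theorem IsHarmonic.integral_mul_inner_frameAlong_eq_zero (hfh : IsHarmonic g h f) {q : N}
    {χ : M → ℝ} (v : 𝔼 m) (hχ : ContMDiff (𝓡 n) 𝓘(ℝ, ℝ) ∞ χ) (hcompact : HasCompactSupport χ)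
    (hsupp : tsupport χ ⊆ f ⁻¹' (extChartAt (𝓡 m) q).source) :
    (Continuous fun z => χ z * h.inner (f z) (frameAlong q v f z) (tension g h f z)) ∧
    ∫ z, χ z * h.inner (f z) (frameAlong q v f z) (tension g h f z) ∂(riemannianVolume g) = 0 := by
  have : LocallyCompactSpace M := Manifold.locallyCompact_of_finiteDimensional (𝓡 n)
  obtain ⟨U, hU, hχU, hUc⟩ := exists_isOpen_superset_and_isCompact_closure hcompact.isCompact
  obtain ⟨ε, hε, hvar⟩ := exists_isVariation_chartVariation v hfh.1 hχ hcompact hsupp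
  have hF := hvar U hχU
  have hpair : ∀ z, h.inner (chartVariation q f χ v 0 z)
      (variationField (chartVariation q f χ v) z) (tension g h (chartVariation q f χ v 0) z) =
        χ z * h.inner (f z) (frameAlong q v f z) (tension g h f z) := fun z =>
    inner_variationField_chartVariation g h fun hz => hsupp (subset_tsupport χ hz)
  have hcrit := (hF.hasDerivAt_energy g h hε hU hUc).unique (hfh.2 U hU hUc ε hε _ hF)
  have hcont := IsSmoothFamily.continuous_inner_variationField_tension g h hε hF.smooth
  simp only [hpair] at hcrit hcont
  exact ⟨hcont, neg_eq_zero.1 hcrit⟩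

theorem IsHarmonic.tension_eq_zero (hfh : IsHarmonic g h f) (x : M) : tension g h f x = 0 := by
  by_contra hτ
  have hx := mem_extChartAt_source (I := 𝓡 m) (f x)
  set q := f x
  set v : 𝔼 m := mfderiv (𝓡 m) 𝓘(ℝ, 𝔼 m) (extChartAt (𝓡 m) q) q (tension g h f x)
  set β : M → ℝ := fun z => h.inner (f z) (frameAlong q v f z) (tension g h f z) with hβ
  have hβx : 0 < β x := by
    have hv : frameAlong q v f x = tension g h f x := coordFrame_mfderiv_chart hx _
    simp only [hβ, hv]
    exact h.pos (f x) _ hτ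
  have hsource : f ⁻¹' (extChartAt (𝓡 m) q).source ∈ 𝓝 x :=
    ((isOpen_extChartAt_source q).preimage hfh.1.continuous).mem_nhds hx
  obtain ⟨χ, -, hχ⟩ := (SmoothBumpFunction.nhds_basis_tsupport (I := 𝓡 n) x).mem_iff.1 hsource
  have hcont := (hfh.integral_mul_inner_frameAlong_eq_zero v χ.contMDiff χ.hasCompactSupport hχ).1
  have hpos : {z | 0 < χ z * β z} ∩ f ⁻¹' (extChartAt (𝓡 m) q).source ∈ 𝓝 x :=
    Filter.inter_mem ((isOpen_lt continuous_const hcont).mem_nhds (by simpa using hβx)) hsource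
  obtain ⟨η, -, hη⟩ := (SmoothBumpFunction.nhds_basis_tsupport (I := 𝓡 n) x).mem_iff.1 hpos
  obtain ⟨hηcont, hηint⟩ := hfh.integral_mul_inner_frameAlong_eq_zero v η.contMDiff
    η.hasCompactSupport fun z hz => (hη hz).2
  refine (hηcont.integral_pos_of_hasCompactSupport_nonneg_nonzero (μ := riemannianVolume g) (x := x)
    η.hasCompactSupport.mul_right (fun z => ?_) (by simpa using hβx.ne')).ne' hηint
  by_cases hz : z ∈ tsupport η
  · exact mul_nonneg η.nonneg (pos_of_mul_pos_right (hη hz).1 χ.nonneg).le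
  · exact (mul_eq_zero_of_left (image_eq_zero_of_notMem_tsupport hz) _).ge

theorem isHarmonic_iff_tension_eq_zero (g : Metric n M) (h : Metric m N)
    (hf : ContMDiff (𝓡 n) (𝓡 m) ∞ f) : IsHarmonic g h f ↔ ∀ x, tension g h f x = 0 :=
  ⟨fun hfh => hfh.tension_eq_zero, isHarmonic_of_tension_eq_zero g h hf⟩

end EulerLagrange

end HarmonicMap

end

theorem theorem1_general {n m : ℕ}
    {M : Type*} [TopologicalSpace M] [ChartedSpace (EuclideanSpace ℝ (Fin n)) M]
    [IsManifold (𝓡 n) ∞ M] [T2Space M] [MeasurableSpace M] [BorelSpace M]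
    {N : Type*} [TopologicalSpace N] [ChartedSpace (EuclideanSpace ℝ (Fin m)) N]
    [IsManifold (𝓡 m) ∞ N]
    (g : HarmonicMap.Metric n M) (h : HarmonicMap.Metric m N)
    (f : M → N) (hf : ContMDiff (𝓡 n) (𝓡 m) ∞ f) :
    (∀ (x : M) (Y : TangentSpace (𝓡 n) x),
      HarmonicMap.divergence g (HarmonicMap.pullbackMetric h f) x Y
          + (1 / 2) * mvfderiv (𝓡 n) (HarmonicMap.energyDensity g h f) x Y
        = -(h.inner (f x) (HarmonicMap.tension g h f x) (mfderiv (𝓡 n) (𝓡 m) f x Y))) ∧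
    (HarmonicMap.IsHarmonic g h f → HarmonicMap.DivergenceIdentity g h f) ∧
    (HarmonicMap.DivergenceIdentity g h f →
      (∀ x : M, Function.Surjective (mfderiv (𝓡 n) (𝓡 m) f x)) →
      HarmonicMap.IsHarmonic g h f) := by
  have hformula := HarmonicMap.divergence_add_half_mvfderiv g h hf
  have hharmonic := HarmonicMap.isHarmonic_iff_tension_eq_zero g h hf
  refine ⟨hformula, fun hharm x Y => ?_, fun hdiv hsurj => hharmonic.2 fun x => ?_⟩
  · have hxY := hformula x Y
    rw [hharmonic.1 hharm x, map_zero, zero_apply, neg_zero] at hxY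
    linarith
  · by_contra hτ
    obtain ⟨Y, hY⟩ := hsurj x (HarmonicMap.tension g h f x)
    have hxY := hformula x Y
    rw [hdiv x Y, hY] at hxY
    linarith [h.pos (f x) _ hτ]

theorem theorem1 {n m : ℕ}
    {M : Type*} [TopologicalSpace M] [ChartedSpace (EuclideanSpace ℝ (Fin n)) M]
    [IsManifold (𝓡 n) ∞ M] [T2Space M] [CompactSpace M] [MeasurableSpace M] [BorelSpace M]
    {N : Type*} [TopologicalSpace N] [ChartedSpace (EuclideanSpace ℝ (Fin m)) N]
    [IsManifold (𝓡 m) ∞ N] [T2Space N]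
    (g : HarmonicMap.Metric n M) (h : HarmonicMap.Metric m N)
    (f : M → N) (hf : ContMDiff (𝓡 n) (𝓡 m) ∞ f) :
    (∀ (x : M) (Y : TangentSpace (𝓡 n) x),
      HarmonicMap.divergence g (HarmonicMap.pullbackMetric h f) x Y
          + (1 / 2) * mvfderiv (𝓡 n) (HarmonicMap.energyDensity g h f) x Y
        = -(h.inner (f x) (HarmonicMap.tension g h f x) (mfderiv (𝓡 n) (𝓡 m) f x Y))) ∧
    (HarmonicMap.IsHarmonic g h f → HarmonicMap.DivergenceIdentity g h f) ∧
    (HarmonicMap.DivergenceIdentity g h f →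
      ((n = m ∧ ∃ Φ : M ≃ₘ^∞⟮𝓡 n, 𝓡 m⟯ N, ⇑Φ = f) ∨
        (m ≤ n ∧ ∀ x : M, Function.Surjective (mfderiv (𝓡 n) (𝓡 m) f x))) →
      HarmonicMap.IsHarmonic g h f) := by
  obtain ⟨hformula, hdiv, hharm⟩ := theorem1_general g h f hf
  refine ⟨hformula, hdiv, fun hid hcase => hharm hid ?_⟩
  rcases hcase with ⟨-, Φ, rfl⟩ | ⟨-, hsurj⟩
  · exact fun x => (Φ.mfderivToContinuousLinearEquiv (by simp) x).surjective
  · exact hsurj
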